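/- Let $m,n,l\ge 1$ be integers and $\Theta\in\mathbb{R}^{l\times n}$. For agents $i=1,\dots,m$ and times $t=1,2,\dots$ let $$y_{i,t}=\Theta x_{i,t}+\eta_{i,t},\qquad x_{i,t}\sim\mathcal N(\mu_{i,t},\sigma_x^2I_n),\qquad \eta_{i,t}\sim\mathcal N(0,\sigma_\eta^2I_l),$$ where the random vectors $x_{i,t},\eta_{i,t}$ (over all $i$ and $t$) are mutually independent, $\sigma_x>0$, $\sigma_\eta\ge 0$, and the means $\mu_{i,t}\in\mathbb{R}^n$ are deterministic with $\hat\mu=\sup_{i,t}\|\mu_{i,t}\|<\infty$. Fix $\delta>0$ and put $$t_1=8n+16\log\tfrac{2}{\delta},\qquad t_2=\Big(\tfrac{16\hat\mu(\sqrt{4n}+\sqrt{2\log\frac{2}{\delta}})}{\sigma_x}\Big)^2,\qquad t_3=2(n+l)\log\tfrac{1}{\delta},$$ $$C_1=8\sigma_\eta\Big(4\sigma_x\sqrt{(n+l)\log\tfrac{9}{\delta}}+\hat\mu\big(\sqrt{2(l+n)}+2\sqrt{\log\tfrac{2}{\delta}}\big)\Big).$$ Let $t\ge 1$ be an integer with $t\ge\frac1m\max(t_1,t_2,t_3)$,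 and let $\bar\mu_t=\frac{4}{mt\sigma_x^2}\sum_{i=1}^m\sum_{j=1}^t\mu_{i,j}\mu_{i,j}^*$. Then, with probability at least $1-4\delta$, the matrix $\sum_{i=1}^m\sum_{j=1}^t x_{i,j}x_{i,j}^*$ is invertible and the centralized least-squares estimate $$\hat\Theta_{t+1}=\Big(\sum_{i=1}^m\sum_{j=1}^t y_{i,j}x_{i,j}^*\Big)\Big(\sum_{i=1}^m\sum_{j=1}^t x_{i,j}x_{i,j}^*\Big)^{-1}$$ satisfies $$\|\hat\Theta_{t+1}-\Theta\|\le\frac{C_1}{\sqrt{mt}\,\sigma_x^2\,\lambda_{\min}(I_n+\bar\mu_t)},$$ where $\|\cdot\|$ is the spectral norm (the Euclidean norm for vectors) and $\lambda_{\min}$ the smallest eigenvalue. (When $\delta\ge 1/4$ the claim is vacuous; the logarithms are positive otherwise.) -/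

import Mathlib

open MeasureTheory ProbabilityTheory
open scoped Matrix.Norms.L2Operator

noncomputable section

namespace DistEst

/-- The double sum `∑ᵢ ∑_{j=1}^t u_{i,j} v_{i,j}*` over all agents `i` and all
time steps `1, …, t`. -/
def crossSum {m p q : ℕ} (u : Fin m → ℕ+ → EuclideanSpace ℝ (Fin p))
    (v : Fin m → ℕ+ → EuclideanSpace ℝ (Fin q)) (t : ℕ+) : Matrix (Fin p) (Fin q) ℝ :=
  ∑ i, ∑ j ∈ Finset.Icc 1 t, Matrix.vecMulVec (u i j).ofLp (v i j).ofLp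

/-- The centralized least-squares estimate computed from the samples `(x_{i,j}, y_{i,j})` of all
agents up to time `t`, namely `(∑ y x*) (∑ x x*)⁻¹`. -/
def globalEstimate {m n l : ℕ} (x : Fin m → ℕ+ → EuclideanSpace ℝ (Fin n))
    (y : Fin m → ℕ+ → EuclideanSpace ℝ (Fin l)) (t : ℕ+) : Matrix (Fin l) (Fin n) ℝ :=
  crossSum y x t * (crossSum x x t)⁻¹

/-- The smallest eigenvalue of a real symmetric matrix. For a positive semidefinite matrix, the only
case used here, it is also the eigenvalue of smallest magnitude. -/
def lambdaMin {n : ℕ} (A : Matrix (Fin n) (Fin n) ℝ) : ℝ := sInf (spectrum ℝ A)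

/-- The matrix `μ̄_t = 4 / (m t σ_x²) ∑ᵢ ∑_{j=1}^t μ_{i,j} μ_{i,j}*`. -/
def meanGram {m n : ℕ} (μ : Fin m → ℕ+ → EuclideanSpace ℝ (Fin n)) (σx : ℝ) (t : ℕ+) :
    Matrix (Fin n) (Fin n) ℝ :=
  (4 / ((m : ℝ) * (t : ℝ) * σx ^ 2)) • crossSum μ μ t

/-- The threshold `t₁`. -/
def t1 (n : ℕ) (δ : ℝ) : ℝ := 8 * n + 16 * Real.log (2 / δ)

/-- The threshold `t₂`. -/
def t2 (n : ℕ) (σx μhat δ : ℝ) : ℝ :=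
  (16 * μhat * (√(4 * n) + √(2 * Real.log (2 / δ))) / σx) ^ 2

/-- The threshold `t₃`. -/
def t3 (n l : ℕ) (δ : ℝ) : ℝ := 2 * ((n : ℝ) + l) * Real.log (1 / δ)

/-- The constant `C₁`. -/
def C1 (n l : ℕ) (σx ση μhat δ : ℝ) : ℝ :=
  8 * ση * (4 * σx * √(((n : ℝ) + l) * Real.log (9 / δ))
    + μhat * (√(2 * ((l : ℝ) + n)) + 2 * √(Real.log (2 / δ))))

/-- The data model: `y_{i,t} = Θ x_{i,t} + η_{i,t}` with `x_{i,t} ∼ N(μ_{i,t}, σ_x² I)` and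
`η_{i,t} ∼ N(0, σ_η² I)`, where all the features and all the noises are mutually independent
(the pairs `(x_{i,t}, η_{i,t})` are mutually independent over agents and times, and within each pair
the two members are independent), and `μhat` is the supremum of the norms of the means. -/
structure GaussianModel {Ω : Type*} [MeasurableSpace Ω] (P : Measure Ω) {m n l : ℕ}
    (Θ : Matrix (Fin l) (Fin n) ℝ) (μ : Fin m → ℕ+ → EuclideanSpace ℝ (Fin n))
    (σx ση μhat : ℝ) (x : Fin m → ℕ+ → Ω → EuclideanSpace ℝ (Fin n))
    (η y : Fin m → ℕ+ → Ω → EuclideanSpace ℝ (Fin l)) : Prop where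
  label : ∀ i j ω, y i j ω = Matrix.toEuclideanLin Θ (x i j ω) + η i j ω
  law_feature : ∀ i j, HasLaw (x i j)
    (multivariateGaussian (μ i j) (σx ^ 2 • (1 : Matrix (Fin n) (Fin n) ℝ))) P
  law_noise : ∀ i j, HasLaw (η i j)
    (multivariateGaussian 0 (ση ^ 2 • (1 : Matrix (Fin l) (Fin l) ℝ))) P
  indep_pairs : iIndepFun (fun (k : Fin m × ℕ+) ω => (x k.1 k.2 ω, η k.1 k.2 ω)) P
  indep_feature_noise : ∀ i j, IndepFun (x i j) (η i j) P
  sup_mean : IsLUB (Set.range fun k : Fin m × ℕ+ => ‖μ k.1 k.2‖) μhat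

end DistEst

end

/-!
The estimation error is `(∑ η x*) (∑ x x*)⁻¹`, so it suffices to bound, simultaneously for all unit
vectors `u` and `w`, the Gram form `∑ ⟪x, u⟫²` from below and the cross form `∑ ⟪x, u⟫ ⟪η, w⟫` from
above. Both expand into forms in standard Gaussian families `g`, `h` and in the deterministic means.

Uniformity over the unit sphere is obtained without nets. If a form is extreme at some `u`, its
exponential is large on average over a small ball around `u`, because pairing opposite points of
the ball cancels the linear terms; the expectation of the average over a larger fixed ball is an
explicit Gaussian integral. For the smallest singular value of `g` the averaged quantity is a tilted
Gaussian density, and the remaining quadratic term is controlled by the Frobenius norm of `g`. The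
forms mixing the means `μ` with a Gaussian family `h` are bounded by the Frobenius norm of
`∑ h μ*`, whose exponential moment is distributed over the rows by Jensen's inequality.
-/

noncomputable section

namespace DistEst

open Metric
open scoped RealInnerProductSpace

section Exponential

/-- The real exponential with values in `ENNReal`, so that exponential moments are lower Lebesgue
integrals and need no integrability side conditions. -/
def eexp (r : ℝ) : ENNReal := ENNReal.ofReal (Real.exp r)

lemma eexp_add (a b : ℝ) : eexp (a + b) = eexp a * eexp b := by
  simp only [eexp, Real.exp_add, ENNReal.ofReal_mul (Real.exp_pos a).le]

lemma eexp_zero : eexp 0 = 1 := by simp [eexp]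

lemma eexp_ne_zero (a : ℝ) : eexp a ≠ 0 := by simp [eexp, Real.exp_pos]

lemma eexp_ne_top (a : ℝ) : eexp a ≠ ⊤ := ENNReal.ofReal_ne_top

lemma eexp_mono {a b : ℝ} (h : a ≤ b) : eexp a ≤ eexp b :=
  ENNReal.ofReal_le_ofReal (Real.exp_le_exp.2 h)

lemma eexp_neg_log {x : ℝ} (hx : 0 < x) : eexp (-Real.log x) = ENNReal.ofReal x⁻¹ := by
  rw [eexp, Real.exp_neg, Real.exp_log hx]

lemma eexp_sum {ι : Type*} (s : Finset ι) (f : ι → ℝ) :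
    eexp (∑ i ∈ s, f i) = ∏ i ∈ s, eexp (f i) := by
  simp only [eexp, Real.exp_sum, ENNReal.ofReal_prod_of_nonneg fun i _ => (Real.exp_pos (f i)).le]

lemma eexp_nat_mul (n : ℕ) (a : ℝ) : eexp (n * a) = eexp a ^ n := by
  simp only [eexp, Real.exp_nat_mul, ENNReal.ofReal_pow (Real.exp_pos a).le]

@[fun_prop]
lemma measurable_eexp : Measurable eexp := by unfold eexp; fun_prop

lemma eexp_sum_mul_le {ι : Type*} [Fintype ι] {p : ι → ℝ} (hp : ∀ i, 0 ≤ p i)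
    (hp1 : ∑ i, p i = 1) (y : ι → ℝ) :
    eexp (∑ i, p i * y i) ≤ ∑ i, ENNReal.ofReal (p i) * eexp (y i) := by
  have h := convexOn_exp.map_sum_le (t := Finset.univ) (w := p) (p := y) (fun i _ => hp i) hp1
    (fun i _ => Set.mem_univ _)
  simp only [smul_eq_mul] at h
  simp only [eexp, ← ENNReal.ofReal_mul (hp _)]
  rw [← ENNReal.ofReal_sum_of_nonneg fun i _ => mul_nonneg (hp i) (Real.exp_pos _).le]
  exact ENNReal.ofReal_le_ofReal h

lemma two_mul_eexp_le {x a b : ℝ} (h : 2 * x ≤ a + b) : 2 * eexp x ≤ eexp a + eexp b := by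
  have hreal : 2 * Real.exp x ≤ Real.exp a + Real.exp b := by
    have hxa := Real.add_one_le_exp (a - x)
    have hxb := Real.add_one_le_exp (b - x)
    rw [Real.exp_sub, le_div_iff₀ (Real.exp_pos x)] at hxa hxb
    nlinarith [Real.exp_pos x]
  rw [eexp, eexp, eexp, ← ENNReal.ofReal_add (Real.exp_pos a).le (Real.exp_pos b).le,
    ← ENNReal.ofReal_ofNat 2, ← ENNReal.ofReal_mul zero_le_two]
  exact ENNReal.ofReal_le_ofReal hreal

lemma le_eexp_sub_of_mul_le {b x : ENNReal} (hb₀ : b ≠ 0) (hb : b ≠ ⊤) {κ Λ : ℝ}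
    (h : b * eexp κ * x ≤ eexp Λ * b) : x ≤ eexp (Λ - κ) := by
  rw [← ENNReal.mul_le_mul_iff_right (mul_ne_zero hb₀ (eexp_ne_zero κ))
    (ENNReal.mul_ne_top hb (eexp_ne_top κ)), mul_assoc b _ (eexp (Λ - κ)), ← eexp_add,
    add_sub_cancel, mul_comm b (eexp Λ)]
  exact h

end Exponential

section Measure

variable {Ω : Type*} [MeasurableSpace Ω]

lemma measure_le_eexp_neg_mul_lintegral (P : Measure Ω) {f : Ω → ℝ} (hf : Measurable f) (c : ℝ) :
    P {ω | c ≤ f ω} ≤ eexp (-c) * ∫⁻ ω, eexp (f ω) ∂P := by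
  calc P {ω | c ≤ f ω} = eexp (-c) * (eexp c * P {ω | c ≤ f ω}) := by
        rw [← mul_assoc, ← eexp_add, neg_add_cancel, eexp_zero, one_mul]
    _ ≤ eexp (-c) * (eexp c * P {ω | eexp c ≤ eexp (f ω)}) := by
        gcongr with ω
        exact eexp_mono
    _ ≤ eexp (-c) * ∫⁻ ω, eexp (f ω) ∂P := by
        gcongr
        exact mul_meas_ge_le_lintegral (measurable_eexp.comp hf) _

/-- An average over `v` takes the place of a union bound over a net. -/
lemma mul_measure_le_of_le_lintegral {V : Type*} [MeasurableSpace V] (P : Measure Ω) [SFinite P]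
    (ν : Measure V) [SFinite ν] {f : Ω → V → ENNReal} (hf : Measurable (Function.uncurry f))
    {s : Set Ω} {A b : ENNReal} (hlower : ∀ ω ∈ s, b ≤ ∫⁻ v, f ω v ∂ν)
    (hupper : ∀ᵐ v ∂ν, ∫⁻ ω, f ω v ∂P ≤ A) : b * P s ≤ A * ν Set.univ :=
  calc b * P s ≤ b * P {ω | b ≤ ∫⁻ v, f ω v ∂ν} := by gcongr; exact hlower
    _ ≤ ∫⁻ ω, ∫⁻ v, f ω v ∂ν ∂P := mul_meas_ge_le_lintegral hf.lintegral_prod_right' b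
    _ = ∫⁻ v, ∫⁻ ω, f ω v ∂P ∂ν := lintegral_lintegral_swap hf.aemeasurable
    _ ≤ ∫⁻ _, A ∂ν := lintegral_mono_ae hupper
    _ = A * ν Set.univ := lintegral_const A

lemma measure_univ_mul_eexp_le_lintegral (μ : Measure Ω) [IsFiniteMeasure μ] {f : Ω → ℝ}
    (hf : Integrable f μ) (hexp : Integrable (fun ω => Real.exp (f ω)) μ) {c : ℝ}
    (hc : c * μ.real Set.univ ≤ ∫ ω, f ω ∂μ) :
    μ Set.univ * eexp c ≤ ∫⁻ ω, eexp (f ω) ∂μ := by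
  have htangent : μ.real Set.univ * Real.exp c ≤ ∫ ω, Real.exp (f ω) ∂μ :=
    calc μ.real Set.univ * Real.exp c
        ≤ Real.exp c * ((1 - c) * μ.real Set.univ + ∫ ω, f ω ∂μ) := by
          nlinarith [Real.exp_pos c]
      _ = ∫ ω, Real.exp c * (1 - c + f ω) ∂μ := by
          rw [integral_const_mul, integral_add (integrable_const _) hf, integral_const,
            smul_eq_mul, mul_comm (1 - c)]
      _ ≤ ∫ ω, Real.exp (f ω) ∂μ := by
          refine integral_mono (((integrable_const _).add hf).const_mul _) hexp fun ω => ?_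
          have h := Real.add_one_le_exp (f ω - c)
          rw [Real.exp_sub, le_div_iff₀ (Real.exp_pos c)] at h
          linarith
  calc μ Set.univ * eexp c = ENNReal.ofReal (μ.real Set.univ * Real.exp c) := by
        rw [ENNReal.ofReal_mul measureReal_nonneg, ofReal_measureReal, eexp]
    _ ≤ ENNReal.ofReal (∫ ω, Real.exp (f ω) ∂μ) := ENNReal.ofReal_le_ofReal htangent
    _ = ∫⁻ ω, eexp (f ω) ∂μ :=
        ofReal_integral_eq_lintegral_ofReal hexp (.of_forall fun ω => (Real.exp_pos _).le)

lemma lintegral_pi_prod {ι : Type*} [Fintype ι] {X : ι → Type*} [∀ i, MeasurableSpace (X i)]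
    (μ : ∀ i, Measure (X i)) [∀ i, IsProbabilityMeasure (μ i)] {f : ∀ i, X i → ENNReal}
    (hf : ∀ i, Measurable (f i)) :
    ∫⁻ ω, ∏ i, f i (ω i) ∂(Measure.pi μ) = ∏ i, ∫⁻ x, f i x ∂(μ i) := by
  rw [lintegral_prod_eq_prod_lintegral_of_indepFun Finset.univ
    (fun i (ω : ∀ i, X i) => f i (ω i)) (iIndepFun_pi fun i => (hf i).aemeasurable)
    fun i => (hf i).comp (measurable_pi_apply i)]
  exact Finset.prod_congr rfl fun i _ => (measurePreserving_eval μ i).lintegral_comp (hf i)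

end Measure

section CrossForm

variable {E F K : Type*} [NormedAddCommGroup E] [InnerProductSpace ℝ E] [NormedAddCommGroup F]
  [InnerProductSpace ℝ F] [Fintype K]

/-- The bilinear form `⟪(∑ₖ bₖ aₖ*) u, w⟫` of the cross matrix of two families of vectors; for
`b = a` and `w = u` it is the quadratic form of the Gram matrix `∑ₖ aₖ aₖ*`. -/
def crossForm (a : K → E) (b : K → F) (u : E) (w : F) : ℝ := ∑ k, ⟪a k, u⟫ * ⟪b k, w⟫

@[fun_prop]
lemma continuous_crossForm {X : Type*} [TopologicalSpace X] {a : X → K → E} {b : X → K → F}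
    {u : X → E} {w : X → F} (ha : Continuous a) (hb : Continuous b) (hu : Continuous u)
    (hw : Continuous w) : Continuous fun x => crossForm (a x) (b x) (u x) (w x) := by
  unfold crossForm; fun_prop

@[fun_prop]
lemma measurable_crossForm [MeasurableSpace E] [OpensMeasurableSpace E] [SecondCountableTopology E]
    [MeasurableSpace F] [OpensMeasurableSpace F] [SecondCountableTopology F] {X : Type*}
    [MeasurableSpace X] {a : X → K → E} {b : X → K → F} {u : X → E} {w : X → F} (ha : Measurable a)
    (hb : Measurable b) (hu : Measurable u) (hw : Measurable w) :
    Measurable fun x => crossForm (a x) (b x) (u x) (w x) := by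
  unfold crossForm; fun_prop

lemma crossForm_comm (a : K → E) (b : K → F) (u : E) (w : F) :
    crossForm a b u w = crossForm b a w u := by
  simp only [crossForm, mul_comm]

lemma crossForm_eq_inner (a : K → E) (b : K → F) (u : E) (w : F) :
    crossForm a b u w = ⟪∑ k, ⟪a k, u⟫ • b k, w⟫ := by
  simp only [crossForm, sum_inner, real_inner_smul_left]

lemma crossForm_smul_smul (a : K → E) (b : K → F) (s t : ℝ) (u : E) (w : F) :
    crossForm a b (s • u) (t • w) = s * t * crossForm a b u w := by
  simp only [crossForm, real_inner_smul_right, Finset.mul_sum]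
  exact Finset.sum_congr rfl fun k _ => by ring

lemma crossForm_self_nonneg (a : K → E) (u : E) : 0 ≤ crossForm a a u u :=
  Finset.sum_nonneg fun _ _ => mul_self_nonneg _

lemma crossForm_parallelogram (a : K → E) (u z : E) :
    crossForm a a (u + z) (u + z) + crossForm a a (u - z) (u - z)
      = 2 * (crossForm a a u u + crossForm a a z z) := by
  simp only [crossForm, inner_add_right, inner_sub_right, Finset.mul_sum,
    ← Finset.sum_add_distrib]
  exact Finset.sum_congr rfl fun k _ => by ring

end CrossForm

section Ball

variable {E : Type*} [NormedAddCommGroup E] [InnerProductSpace ℝ E] [FiniteDimensional ℝ E]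
  [MeasurableSpace E] [BorelSpace E]

lemma volume_ball_mul {r : ℝ} (hr : 0 < r) (s : ℝ) :
    volume (ball (0 : E) (r * s))
      = eexp (Module.finrank ℝ E * Real.log r) * volume (ball (0 : E) s) := by
  rw [Measure.addHaar_ball_mul_of_pos _ _ hr, eexp_nat_mul, eexp, Real.exp_log hr,
    ENNReal.ofReal_pow hr.le]

lemma setLIntegral_ball_eq_add (f : E → ENNReal) (c : E) (r : ℝ) :
    ∫⁻ v in ball c r, f v = ∫⁻ z in ball 0 r, f (c + z) := by
  rw [← (measurePreserving_add_left volume c).setLIntegral_comp_preimage_emb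
    (measurableEmbedding_addLeft c) f (ball c r)]
  simp

lemma setLIntegral_ball_eq_sub (f : E → ENNReal) (c : E) (r : ℝ) :
    ∫⁻ v in ball c r, f v = ∫⁻ z in ball 0 r, f (c - z) := by
  rw [setLIntegral_ball_eq_add, ← (Measure.measurePreserving_neg
    (volume : Measure E)).setLIntegral_comp_preimage_emb
    (MeasurableEquiv.neg E).measurableEmbedding (fun z => f (c + z)) (ball 0 r)]
  simp [sub_eq_add_neg]

/-- Pairing opposite points of the ball cancels the terms of `f` that are linear in `z`. -/
lemma setLIntegral_ball_eexp_le {f φ : E → ℝ} (hf : Measurable f) (c : E) {r : ℝ}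
    (h : ∀ z ∈ ball (0 : E) r, 2 * φ z ≤ f (c + z) + f (c - z)) :
    ∫⁻ z in ball 0 r, eexp (φ z) ≤ ∫⁻ v in ball c r, eexp (f v) := by
  set I := ∫⁻ v in ball c r, eexp (f v) with hI
  have htwo : 2 * ∫⁻ z in ball 0 r, eexp (φ z) ≤ 2 * I :=
    calc 2 * ∫⁻ z in ball 0 r, eexp (φ z) ≤ ∫⁻ z in ball 0 r, 2 * eexp (φ z) :=
          lintegral_const_mul_le _ _
      _ ≤ ∫⁻ z in ball 0 r, (eexp (f (c + z)) + eexp (f (c - z))) :=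
          setLIntegral_mono' measurableSet_ball fun z hz => two_mul_eexp_le (h z hz)
      _ = 2 * I := by
          rw [lintegral_add_left (by fun_prop), two_mul, hI]
          congr 1
          exacts [(setLIntegral_ball_eq_add (fun v => eexp (f v)) c r).symm,
            (setLIntegral_ball_eq_sub (fun v => eexp (f v)) c r).symm]
  exact (ENNReal.mul_le_mul_iff_right two_ne_zero ENNReal.ofNat_ne_top).1 htwo

lemma volume_ball_mul_eexp_inner_le (a c : E) (r : ℝ) :
    volume (ball (0 : E) r) * eexp ⟪a, c⟫ ≤ ∫⁻ v in ball c r, eexp ⟪a, v⟫ := by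
  rw [mul_comm, ← setLIntegral_const]
  refine setLIntegral_ball_eexp_le (φ := fun _ => ⟪a, c⟫) (by fun_prop) c fun z _ => ?_
  rw [inner_add_right, inner_sub_right]
  linarith

lemma integrableOn_ball {f : E → ℝ} (hf : Continuous f) (c : E) (r : ℝ) :
    IntegrableOn f (ball c r) :=
  (hf.continuousOn.integrableOn_compact (isCompact_closedBall c r)).mono_set
    ball_subset_closedBall

lemma integral_ball_inner_sq_eq {g h : E} (hgh : ‖g‖ = ‖h‖) (r : ℝ) :
    ∫ z in ball 0 r, ⟪g, z⟫ ^ 2 = ∫ z in ball 0 r, ⟪h, z⟫ ^ 2 := by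
  set A := (ℝ ∙ (g - h))ᗮ.reflection
  have hA : A g = h := Submodule.reflection_sub hgh
  rw [← A.measurePreserving.setIntegral_preimage_emb A.toHomeomorph.measurableEmbedding
    (fun z => ⟪h, z⟫ ^ 2) (ball 0 r), ← hA]
  simp

lemma finrank_mul_integral_ball_inner_sq_le (g : E) (r : ℝ) :
    Module.finrank ℝ E * ∫ z in ball 0 r, ⟪g, z⟫ ^ 2
      ≤ ‖g‖ ^ 2 * (r ^ 2 * volume.real (ball (0 : E) r)) := by
  set e := stdOrthonormalBasis ℝ E
  have hcoord : ∀ i, ∫ z in ball 0 r, ⟪g, z⟫ ^ 2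
      = ∫ z in ball (0 : E) r, ‖g‖ ^ 2 * ⟪e i, z⟫ ^ 2 := fun i => by
    rw [integral_ball_inner_sq_eq (h := ‖g‖ • e i) (by simp [norm_smul])]
    simp only [real_inner_smul_left, mul_pow]
  calc Module.finrank ℝ E * ∫ z in ball 0 r, ⟪g, z⟫ ^ 2
      = ∑ i, ∫ z in ball (0 : E) r, ‖g‖ ^ 2 * ⟪e i, z⟫ ^ 2 := by
        rw [← Finset.sum_congr rfl fun i _ => hcoord i]; simp
    _ = ∫ z in ball (0 : E) r, ‖g‖ ^ 2 * ‖z‖ ^ 2 := by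
        rw [← integral_finsetSum _ fun i _ => integrableOn_ball (by fun_prop) 0 r]
        simp only [← Finset.mul_sum, e.sum_sq_inner_right]
    _ ≤ ∫ z in ball (0 : E) r, ‖g‖ ^ 2 * r ^ 2 := by
        refine setIntegral_mono_on (integrableOn_ball (by fun_prop) 0 r)
          (integrableOn_ball (by fun_prop) 0 r) measurableSet_ball fun z hz => ?_
        gcongr
        exact (mem_ball_zero_iff.1 hz).le
    _ = ‖g‖ ^ 2 * (r ^ 2 * volume.real (ball (0 : E) r)) := by
        rw [setIntegral_const, smul_eq_mul]; ring

lemma integral_ball_crossForm_self_le {K : Type*} [Fintype K] [Nontrivial E] {g : K → E} {T : ℝ}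
    (hT : ∑ k, ‖g k‖ ^ 2 ≤ Module.finrank ℝ E * T) (r : ℝ) :
    ∫ z in ball 0 r, crossForm g g z z ≤ r ^ 2 * T * volume.real (ball (0 : E) r) := by
  have hd : (0 : ℝ) < Module.finrank ℝ E := Nat.cast_pos.2 Module.finrank_pos
  set V := volume.real (ball (0 : E) r)
  simp only [crossForm, ← sq]
  refine le_of_mul_le_mul_left ?_ hd
  rw [integral_finsetSum _ fun k _ => integrableOn_ball (by fun_prop) 0 r, Finset.mul_sum]
  calc ∑ k, Module.finrank ℝ E * ∫ z in ball 0 r, ⟪g k, z⟫ ^ 2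
      ≤ ∑ k, ‖g k‖ ^ 2 * (r ^ 2 * V) :=
        Finset.sum_le_sum fun k _ => finrank_mul_integral_ball_inner_sq_le (g k) r
    _ ≤ Module.finrank ℝ E * T * (r ^ 2 * V) := by rw [← Finset.sum_mul]; gcongr
    _ = Module.finrank ℝ E * (r ^ 2 * T * V) := by ring

lemma volume_ball_mul_eexp_crossForm_self_le {K : Type*} [Fintype K] [Nontrivial E] {g : K → E}
    {T : ℝ} (hT : ∑ k, ‖g k‖ ^ 2 ≤ Module.finrank ℝ E * T) {β : ℝ} (hβ : 0 ≤ β) (κ r : ℝ) :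
    volume (ball (0 : E) r) * eexp (κ - β * (r ^ 2 * T))
      ≤ ∫⁻ z in ball 0 r, eexp (κ - β * crossForm g g z z) := by
  have : IsFiniteMeasure (volume.restrict (ball (0 : E) r)) := ⟨by simp [measure_ball_lt_top]⟩
  rw [← Measure.restrict_apply_univ (ball (0 : E) r)]
  refine measure_univ_mul_eexp_le_lintegral _ (integrableOn_ball (by fun_prop) 0 r)
    (integrableOn_ball (by fun_prop) 0 r) ?_
  rw [integral_sub (integrable_const κ) (integrableOn_ball (by fun_prop) 0 r),
    integral_const_mul, setIntegral_const, smul_eq_mul, measureReal_restrict_apply_univ]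
  nlinarith [integral_ball_crossForm_self_le hT r]

end Ball

section Gaussian

lemma lintegral_eexp_mul_gaussianReal (c : ℝ) :
    ∫⁻ x, eexp (c * x) ∂(gaussianReal 0 1) = eexp (c ^ 2 / 2) := by
  have hmgf : ∫ x, Real.exp (c * x) ∂(gaussianReal 0 1) = Real.exp (c ^ 2 / 2) := by
    simpa [mgf] using congrFun (mgf_fun_id_gaussianReal (μ := 0) (v := 1)) c
  simp only [eexp]
  rw [← ofReal_integral_eq_lintegral_ofReal (integrable_exp_mul_gaussianReal c)
    (.of_forall fun x => (Real.exp_pos _).le), hmgf]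

lemma lintegral_eexp_sq_gaussianReal {b : ℝ} (hb : 2 * b < 1) :
    ∫⁻ x, eexp (b * x ^ 2) ∂(gaussianReal 0 1) = eexp (-(Real.log (1 - 2 * b) / 2)) := by
  have hpos : 0 < 1 - 2 * b := by linarith
  have hdensity : ∀ x : ℝ, (gaussianPDF 0 1 * fun x => eexp (b * x ^ 2)) x
      = ENNReal.ofReal ((√(2 * Real.pi))⁻¹ * Real.exp (-((1 - 2 * b) / 2) * x ^ 2)) := fun x => by
    simp only [Pi.mul_apply, gaussianPDF, gaussianPDFReal, eexp, NNReal.coe_one, mul_one, sub_zero]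
    rw [← ENNReal.ofReal_mul (by positivity), mul_assoc, ← Real.exp_add]
    ring_nf
  have hsqrt : √(Real.pi / ((1 - 2 * b) / 2)) = √(2 * Real.pi) * (√(1 - 2 * b))⁻¹ := by
    rw [show Real.pi / ((1 - 2 * b) / 2) = 2 * Real.pi * (1 - 2 * b)⁻¹ by field_simp,
      Real.sqrt_mul (by positivity), Real.sqrt_inv]
  rw [gaussianReal_of_var_ne_zero 0 one_ne_zero,
    lintegral_withDensity_eq_lintegral_mul _ (measurable_gaussianPDF 0 1) (by fun_prop),
    lintegral_congr hdensity, ← ofReal_integral_eq_lintegral_ofReal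
    ((integrable_exp_neg_mul_sq (by linarith)).const_mul _) (.of_forall fun x => by positivity),
    integral_const_mul, integral_gaussian, hsqrt, inv_mul_cancel_left₀ (by positivity), eexp,
    Real.exp_neg, Real.exp_half, Real.exp_log hpos]

variable {E F : Type*} [NormedAddCommGroup E] [InnerProductSpace ℝ E] [FiniteDimensional ℝ E]
  [MeasurableSpace E] [BorelSpace E] [NormedAddCommGroup F] [InnerProductSpace ℝ F]
  [FiniteDimensional ℝ F] [MeasurableSpace F] [BorelSpace F]

lemma map_inner_stdGaussian (v : E) :
    (stdGaussian E).map (fun x => ⟪v, x⟫) = (gaussianReal 0 1).map (‖v‖ * ·) := by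
  have h := IsGaussian.map_eq_gaussianReal (μ := stdGaussian E) (innerSL ℝ v)
  rw [integral_strongDual_stdGaussian, variance_dual_stdGaussian, innerSL_apply_norm] at h
  rw [gaussianReal_map_const_mul, mul_zero, mul_one]
  exact h.trans (congrArg _ (Real.toNNReal_of_nonneg (sq_nonneg _)))

lemma lintegral_inner_stdGaussian (v : E) {f : ℝ → ENNReal} (hf : Measurable f) :
    ∫⁻ x, f ⟪v, x⟫ ∂(stdGaussian E) = ∫⁻ x, f (‖v‖ * x) ∂(gaussianReal 0 1) := by
  rw [← lintegral_map hf (by fun_prop), map_inner_stdGaussian, lintegral_map hf (by fun_prop)]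

lemma lintegral_eexp_inner_stdGaussian (v : E) :
    ∫⁻ x, eexp ⟪v, x⟫ ∂(stdGaussian E) = eexp (‖v‖ ^ 2 / 2) := by
  rw [lintegral_inner_stdGaussian v measurable_eexp, lintegral_eexp_mul_gaussianReal]

lemma lintegral_eexp_inner_sq_stdGaussian (v : E) {b : ℝ} (hb : 2 * b * ‖v‖ ^ 2 < 1) :
    ∫⁻ x, eexp (b * ⟪v, x⟫ ^ 2) ∂(stdGaussian E)
      = eexp (-(Real.log (1 - 2 * b * ‖v‖ ^ 2) / 2)) := by
  rw [lintegral_inner_stdGaussian v (f := fun y => eexp (b * y ^ 2)) (by fun_prop)]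
  simp only [mul_pow, ← mul_assoc b]
  rw [lintegral_eexp_sq_gaussianReal (by linarith), mul_assoc 2 b]

lemma lintegral_eexp_normSq_stdGaussian {b : ℝ} (hb : 2 * b < 1) :
    ∫⁻ x, eexp (b * ‖x‖ ^ 2) ∂(stdGaussian E)
      = eexp (-(Module.finrank ℝ E * Real.log (1 - 2 * b) / 2)) := by
  set e := stdOrthonormalBasis ℝ E
  have hnorm : ∀ x : Fin (Module.finrank ℝ E) → ℝ,
      ‖∑ i, x i • e i‖ ^ 2 = ∑ i, x i ^ 2 := fun x => by
    rw [← e.sum_sq_inner_right]; simp [e.orthonormal.inner_right_fintype]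
  rw [stdGaussian_eq_map_pi_orthonormalBasis e, lintegral_map (by fun_prop) (by fun_prop)]
  simp only [hnorm, Finset.mul_sum, eexp_sum]
  rw [lintegral_pi_prod (fun _ => gaussianReal 0 1) (f := fun _ x => eexp (b * x ^ 2))
    (fun _ => by fun_prop)]
  simp only [lintegral_eexp_sq_gaussianReal hb, Finset.prod_const, ← eexp_nat_mul]
  congr 1
  simp only [Finset.card_univ, Fintype.card_fin]
  ring

/-- The law of a family of independent standard Gaussian vectors of `E` indexed by `K`. -/
abbrev stdGaussianPi (K E : Type*) [Fintype K] [NormedAddCommGroup E] [InnerProductSpace ℝ E]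
    [FiniteDimensional ℝ E] [MeasurableSpace E] [BorelSpace E] : Measure (K → E) :=
  Measure.pi fun _ => stdGaussian E

variable {K : Type*} [Fintype K]

lemma lintegral_eexp_sum_stdGaussianPi {f : K → E → ℝ} (hf : ∀ k, Measurable (f k)) :
    ∫⁻ g, eexp (∑ k, f k (g k)) ∂(stdGaussianPi K E)
      = ∏ k, ∫⁻ x, eexp (f k x) ∂(stdGaussian E) := by
  simp only [eexp_sum]
  exact lintegral_pi_prod _ fun k => measurable_eexp.comp (hf k)

lemma lintegral_eexp_sum_inner (c : K → E) :
    ∫⁻ g, eexp (∑ k, ⟪c k, g k⟫) ∂(stdGaussianPi K E) = eexp (∑ k, ‖c k‖ ^ 2 / 2) := by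
  rw [lintegral_eexp_sum_stdGaussianPi fun k => by fun_prop]
  simp only [lintegral_eexp_inner_stdGaussian, eexp_sum]

lemma lintegral_eexp_crossForm_self (v : E) {b : ℝ} (hb : 2 * b * ‖v‖ ^ 2 < 1) :
    ∫⁻ g, eexp (b * crossForm g g v v) ∂(stdGaussianPi K E)
      = eexp (-(Fintype.card K * Real.log (1 - 2 * b * ‖v‖ ^ 2) / 2)) := by
  simp only [crossForm, ← sq, Finset.mul_sum, real_inner_comm v]
  rw [lintegral_eexp_sum_stdGaussianPi (f := fun _ x => b * ⟪v, x⟫ ^ 2) fun _ => by fun_prop]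
  simp only [lintegral_eexp_inner_sq_stdGaussian v hb, Finset.prod_const, Finset.card_univ,
    ← eexp_nat_mul]
  ring_nf

lemma lintegral_eexp_sum_normSq {b : ℝ} (hb : 2 * b < 1) :
    ∫⁻ g, eexp (b * ∑ k, ‖g k‖ ^ 2) ∂(stdGaussianPi K E)
      = eexp (-(Fintype.card K * (Module.finrank ℝ E * Real.log (1 - 2 * b)) / 2)) := by
  simp only [Finset.mul_sum]
  rw [lintegral_eexp_sum_stdGaussianPi (f := fun _ x => b * ‖x‖ ^ 2) fun _ => by fun_prop]
  simp only [lintegral_eexp_normSq_stdGaussian hb, Finset.prod_const, Finset.card_univ,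
    ← eexp_nat_mul]
  ring_nf

lemma lintegral_eexp_crossForm_le {θ : ℝ} (hθ : θ ^ 2 < 1) {u : E} {w : F} (hu : ‖u‖ ≤ 1)
    (hw : ‖w‖ ≤ 1) :
    ∫⁻ p, eexp (θ * crossForm p.1 p.2 u w) ∂((stdGaussianPi K E).prod (stdGaussianPi K F))
      ≤ eexp (-(Fintype.card K * Real.log (1 - θ ^ 2) / 2)) := by
  have hu2 : ‖u‖ ^ 2 ≤ 1 := pow_le_one₀ (norm_nonneg u) hu
  have hw2 : ‖w‖ ^ 2 ≤ 1 := pow_le_one₀ (norm_nonneg w) hw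
  have hθuw : θ ^ 2 * ‖w‖ ^ 2 * ‖u‖ ^ 2 ≤ θ ^ 2 :=
    (mul_le_of_le_one_right (by positivity) hu2).trans (mul_le_of_le_one_right (sq_nonneg θ) hw2)
  have hinner : ∀ g : K → E, ∫⁻ h, eexp (θ * crossForm g h u w) ∂(stdGaussianPi K F)
      = eexp (θ ^ 2 * ‖w‖ ^ 2 / 2 * crossForm g g u u) := fun g => by
    have hlin : ∀ h : K → F, θ * crossForm g h u w = ∑ k, ⟪(θ * ⟪g k, u⟫) • w, h k⟫ := fun h => by
      simp only [crossForm, Finset.mul_sum, real_inner_smul_left, real_inner_comm w, mul_assoc]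
    rw [lintegral_congr fun h => congrArg eexp (hlin h), lintegral_eexp_sum_inner]
    simp only [crossForm, Finset.mul_sum, norm_smul, mul_pow, Real.norm_eq_abs, sq_abs]
    congr 1
    exact Finset.sum_congr rfl fun k _ => by ring
  rw [lintegral_prod _ (by fun_prop)]
  simp only [hinner]
  rw [lintegral_eexp_crossForm_self u (by linarith)]
  refine eexp_mono ?_
  have hlog : Real.log (1 - θ ^ 2) ≤ Real.log (1 - 2 * (θ ^ 2 * ‖w‖ ^ 2 / 2) * ‖u‖ ^ 2) :=
    Real.log_le_log (by linarith) (by linarith)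
  gcongr

end Gaussian

section LogBounds

lemma mul_log_le_of_pow_le {x : ℝ} (hx : 0 < x) {p q : ℕ} (h : x ^ q ≤ 2.7182818283 ^ p) :
    q * Real.log x ≤ p := by
  rw [← Real.log_pow, Real.log_le_iff_le_exp (by positivity), ← Real.exp_one_pow]
  exact h.trans (pow_le_pow_left₀ (by norm_num) Real.exp_one_gt_d9.le p)

lemma le_mul_log_of_le_pow {x : ℝ} (hx : 0 < x) {p q : ℕ} (h : 2.7182818286 ^ p ≤ x ^ q) :
    p ≤ q * Real.log x := by
  rw [← Real.log_pow, Real.le_log_iff_exp_le (by positivity), ← Real.exp_one_pow]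
  exact (pow_le_pow_left₀ (Real.exp_pos 1).le Real.exp_one_lt_d9.le p).trans h

end LogBounds

section SmallestSingularValue

variable {K E : Type*} [Fintype K] [NormedAddCommGroup E] [InnerProductSpace ℝ E]

/-- The logarithm of the density, relative to standard Gaussian samples, of the samples whose
component along `v` has its precision raised from `1` to `1 + 2 * β * ‖v‖ ^ 2`. -/
def tilt (β : ℝ) (g : K → E) (v : E) : ℝ :=
  Fintype.card K * Real.log (1 + 2 * β * ‖v‖ ^ 2) / 2 - β * crossForm g g v v

@[fun_prop]
lemma measurable_tilt [MeasurableSpace E] [OpensMeasurableSpace E] [SecondCountableTopology E]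
    {X : Type*} [MeasurableSpace X] (β : ℝ) {g : X → K → E} {v : X → E} (hg : Measurable g)
    (hv : Measurable v) : Measurable fun x => tilt β (g x) (v x) := by
  unfold tilt; fun_prop

lemma lintegral_eexp_tilt [FiniteDimensional ℝ E] [MeasurableSpace E] [BorelSpace E] {β : ℝ}
    (hβ : 0 ≤ β) (v : E) : ∫⁻ g, eexp (tilt β g v) ∂(stdGaussianPi K E) = 1 := by
  have hsplit : ∀ g : K → E, eexp (tilt β g v)
      = eexp (Fintype.card K * Real.log (1 + 2 * β * ‖v‖ ^ 2) / 2)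
        * eexp (-β * crossForm g g v v) := fun g => by
    rw [← eexp_add, tilt, neg_mul, sub_eq_add_neg]
  have hneg : 2 * -β * ‖v‖ ^ 2 < 1 := by nlinarith [mul_nonneg hβ (sq_nonneg ‖v‖)]
  simp only [hsplit]
  rw [lintegral_const_mul _ (by fun_prop), lintegral_eexp_crossForm_self v hneg, ← eexp_add,
    ← eexp_zero]
  ring_nf

lemma le_one_add_normSq_mul_one_add_normSq {β ρ : ℝ} (hβ : 1 / 2 ≤ β) {u z : E} (hu : ‖u‖ = 1)
    (hz : ‖z‖ ≤ ρ) :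
    (1 + 2 * β) ^ 2 - 4 * β * (2 * β - 1) * ρ ^ 2
      ≤ (1 + 2 * β * ‖u + z‖ ^ 2) * (1 + 2 * β * ‖u - z‖ ^ 2) := by
  have hcs : ⟪u, z⟫ ^ 2 ≤ ‖z‖ ^ 2 := by
    rw [sq_le_sq, abs_norm]
    simpa [hu] using abs_real_inner_le_norm u z
  have hz2 : ‖z‖ ^ 2 ≤ ρ ^ 2 := pow_le_pow_left₀ (norm_nonneg z) hz 2
  rw [norm_add_sq_real, norm_sub_sq_real, hu]
  calc (1 + 2 * β) ^ 2 - 4 * β * (2 * β - 1) * ρ ^ 2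
      ≤ (1 + 2 * β) ^ 2 - 4 * β * (2 * β - 1) * ‖z‖ ^ 2 := by
        have : 0 ≤ 4 * β * (2 * β - 1) := mul_nonneg (by linarith) (by linarith)
        gcongr
    _ ≤ (1 + 2 * β * (1 + ‖z‖ ^ 2)) ^ 2 - 16 * β ^ 2 * ‖z‖ ^ 2 := by
        nlinarith [sq_nonneg (β * ‖z‖ ^ 2)]
    _ ≤ (1 + 2 * β * (1 + ‖z‖ ^ 2)) ^ 2 - 16 * β ^ 2 * ⟪u, z⟫ ^ 2 := by gcongr
    _ = _ := by ring

lemma le_tilt_add_tilt {β ρ : ℝ} (hβ : 1 / 2 ≤ β)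
    (hγ : 0 < (1 + 2 * β) ^ 2 - 4 * β * (2 * β - 1) * ρ ^ 2) (g : K → E) {u z : E} (hu : ‖u‖ = 1)
    (hz : ‖z‖ ≤ ρ) :
    Fintype.card K * Real.log ((1 + 2 * β) ^ 2 - 4 * β * (2 * β - 1) * ρ ^ 2) / 2
        - 2 * β * (crossForm g g u u + crossForm g g z z)
      ≤ tilt β g (u + z) + tilt β g (u - z) := by
  have hpos : ∀ v : E, 0 < 1 + 2 * β * ‖v‖ ^ 2 := fun v => by positivity
  have hlog := Real.log_le_log hγ (le_one_add_normSq_mul_one_add_normSq hβ hu hz)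
  rw [Real.log_mul (hpos _).ne' (hpos _).ne'] at hlog
  have hcard := mul_le_mul_of_nonneg_left hlog (Nat.cast_nonneg' (Fintype.card K) (α := ℝ))
  unfold tilt
  linear_combination hcard / 2 + β * crossForm_parallelogram g u z

variable [FiniteDimensional ℝ E] [Nontrivial E] [MeasurableSpace E] [BorelSpace E]

lemma volume_ball_mul_le_lintegral_eexp_tilt {β ρ Q T : ℝ} (hβ : 1 / 2 ≤ β)
    (hγ : 0 < (1 + 2 * β) ^ 2 - 4 * β * (2 * β - 1) * ρ ^ 2) {g : K → E} {u : E} (hu : ‖u‖ = 1)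
    (hQ : crossForm g g u u ≤ Q) (hT : ∑ k, ‖g k‖ ^ 2 ≤ Module.finrank ℝ E * T) :
    volume (ball (0 : E) ρ)
        * eexp (Fintype.card K * Real.log ((1 + 2 * β) ^ 2 - 4 * β * (2 * β - 1) * ρ ^ 2) / 4
          - β * (Q + ρ ^ 2 * T))
      ≤ ∫⁻ v in ball 0 (1 + ρ), eexp (tilt β g v) := by
  have hβ0 : 0 ≤ β := by linarith
  set κ := Fintype.card K * Real.log ((1 + 2 * β) ^ 2 - 4 * β * (2 * β - 1) * ρ ^ 2) / 4 - β * Q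
    with hκ
  calc _ = volume (ball (0 : E) ρ) * eexp (κ - β * (ρ ^ 2 * T)) := by rw [hκ]; ring_nf
    _ ≤ ∫⁻ z in ball 0 ρ, eexp (κ - β * crossForm g g z z) :=
        volume_ball_mul_eexp_crossForm_self_le hT hβ0 κ ρ
    _ ≤ ∫⁻ v in ball u ρ, eexp (tilt β g v) := by
        refine setLIntegral_ball_eexp_le (by fun_prop) u fun z hz => ?_
        have htilt := le_tilt_add_tilt hβ hγ g hu (mem_ball_zero_iff.1 hz).le
        linarith [mul_le_mul_of_nonneg_left hQ hβ0]
    _ ≤ ∫⁻ v in ball 0 (1 + ρ), eexp (tilt β g v) :=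
        lintegral_mono_set (ball_subset_ball' (by rw [dist_zero_right, hu, add_comm]))

/-- If the Gram form of `g` is small at `u`, the tilted densities at `g` are large near `u`. -/
lemma measure_exists_crossForm_le_and_sum_normSq_le {β ρ Q T : ℝ} (hβ : 1 / 2 ≤ β) (hρ : 0 < ρ)
    (hγ : 0 < (1 + 2 * β) ^ 2 - 4 * β * (2 * β - 1) * ρ ^ 2) :
    stdGaussianPi K E {g | (∃ u, ‖u‖ = 1 ∧ crossForm g g u u ≤ Q)
        ∧ ∑ k, ‖g k‖ ^ 2 ≤ Module.finrank ℝ E * T}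
      ≤ eexp (Module.finrank ℝ E * Real.log ((1 + ρ) / ρ)
        - (Fintype.card K * Real.log ((1 + 2 * β) ^ 2 - 4 * β * (2 * β - 1) * ρ ^ 2) / 4
          - β * (Q + ρ ^ 2 * T))) := by
  refine le_eexp_sub_of_mul_le (measure_ball_pos volume (0 : E) hρ).ne'
    (measure_ball_lt_top (μ := volume) (x := (0 : E))).ne ?_
  rw [← volume_ball_mul (by positivity), div_mul_cancel₀ _ hρ.ne',
    ← Measure.restrict_apply_univ (ball (0 : E) (1 + ρ)),
    ← one_mul ((volume.restrict (ball (0 : E) (1 + ρ))) Set.univ)]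
  refine mul_measure_le_of_le_lintegral (stdGaussianPi K E) (volume.restrict (ball 0 (1 + ρ)))
    (f := fun g v => eexp (tilt β g v))
    (measurable_eexp.comp (measurable_tilt β measurable_fst measurable_snd)) ?_
    (.of_forall fun v => (lintegral_eexp_tilt (by linarith) v).le)
  rintro g ⟨⟨u, hu, hQ⟩, hT⟩
  exact volume_ball_mul_le_lintegral_eexp_tilt hβ hγ hu hQ hT

lemma measure_le_sum_normSq :
    stdGaussianPi K E {g | Module.finrank ℝ E * (8 / 5 * Fintype.card K) ≤ ∑ k, ‖g k‖ ^ 2}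
      ≤ eexp (-(Fintype.card K / 16)) := by
  set N := (Fintype.card K : ℝ)
  set d := (Module.finrank ℝ E : ℝ)
  have hd : 1 ≤ d := Nat.one_le_cast.2 Module.finrank_pos
  have hNd : N ≤ N * d := le_mul_of_one_le_right (Nat.cast_nonneg _) hd
  have hlog : -Real.log (1 - 2 * (3 / 16)) ≤ 19 / 40 := by
    rw [← Real.log_inv]
    have hinv := mul_log_le_of_pow_le (x := (1 - 2 * (3 / 16))⁻¹) (p := 19) (q := 40)
      (by norm_num) (by norm_num)
    push_cast at hinv
    linarith
  calc stdGaussianPi K E {g | d * (8 / 5 * N) ≤ ∑ k, ‖g k‖ ^ 2}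
      ≤ stdGaussianPi K E {g | 3 / 16 * (d * (8 / 5 * N)) ≤ 3 / 16 * ∑ k, ‖g k‖ ^ 2} := by
        refine measure_mono fun g (hg : d * (8 / 5 * N) ≤ _) => ?_
        exact mul_le_mul_of_nonneg_left hg (by norm_num)
    _ ≤ eexp (-(3 / 16 * (d * (8 / 5 * N))) + -(N * (d * Real.log (1 - 2 * (3 / 16))) / 2)) := by
        rw [eexp_add, ← lintegral_eexp_sum_normSq (by norm_num)]
        exact measure_le_eexp_neg_mul_lintegral _ (by fun_prop) _
    _ ≤ eexp (-(N / 16)) := eexp_mono (by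
        nlinarith [mul_le_mul_of_nonneg_left hlog ((Nat.cast_nonneg _).trans hNd)])

lemma measure_exists_crossForm_self_lt {L : ℝ} (hL : 0 ≤ L)
    (hN : 8 * Module.finrank ℝ E + 16 * L ≤ Fintype.card K) :
    stdGaussianPi K E {g | ∃ u, ‖u‖ = 1 ∧ crossForm g g u u < 51 / 200 * Fintype.card K}
      ≤ 2 * eexp (-L) := by
  set N := (Fintype.card K : ℝ)
  set d := (Module.finrank ℝ E : ℝ)
  have hd : 0 ≤ d := Nat.cast_nonneg _
  set small : Set (K → E) := {g | (∃ u, ‖u‖ = 1 ∧ crossForm g g u u ≤ 51 / 200 * N)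
    ∧ ∑ k, ‖g k‖ ^ 2 ≤ d * (8 / 5 * N)}
  set large : Set (K → E) := {g | d * (8 / 5 * N) ≤ ∑ k, ‖g k‖ ^ 2}
  have hsmall : stdGaussianPi K E small ≤ eexp (-L) := by
    refine (measure_exists_crossForm_le_and_sum_normSq_le (β := 7 / 6) (ρ := 1 / 6) (by norm_num)
      (by norm_num) (by norm_num)).trans (eexp_mono ?_)
    have hlog_seven := mul_log_le_of_pow_le (x := 7) (p := 39) (q := 20) (by norm_num)
      (by norm_num)
    have hlog_gain := le_mul_log_of_le_pow (x := 886 / 81) (p := 19) (q := 8) (by norm_num)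
      (by norm_num)
    norm_num at hlog_seven hlog_gain ⊢
    nlinarith
  have hlarge : stdGaussianPi K E large ≤ eexp (-L) :=
    measure_le_sum_normSq.trans (eexp_mono (by linarith))
  rw [two_mul]
  refine (measure_mono ?_).trans ((measure_union_le small large).trans (add_le_add hsmall hlarge))
  rintro g ⟨u, hu, hlt⟩
  exact (le_total (∑ k, ‖g k‖ ^ 2) (d * (8 / 5 * N))).imp (fun h => ⟨⟨u, hu, hlt.le⟩, h⟩) id

end SmallestSingularValue

section DeterministicCross

variable {E F K : Type*} [NormedAddCommGroup E] [InnerProductSpace ℝ E] [NormedAddCommGroup F]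
  [InnerProductSpace ℝ F] [Fintype K]

lemma crossForm_eq_sum_orthonormalBasis {ι : Type*} [Fintype ι] (e : OrthonormalBasis ι ℝ E)
    (a : K → E) (b : K → F) (u : E) (w : F) :
    crossForm a b u w = ∑ i, ⟪e i, u⟫ * crossForm a b (e i) w := by
  simp only [crossForm, Finset.mul_sum]
  rw [Finset.sum_comm]
  refine Finset.sum_congr rfl fun k _ => ?_
  rw [← e.sum_inner_mul_inner (a k) u, Finset.sum_mul]
  exact Finset.sum_congr rfl fun i _ => by ring

lemma sq_crossForm_le {ι : Type*} [Fintype ι] (e : OrthonormalBasis ι ℝ E) (a : K → E) (b : K → F)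
    {u : E} {w : F} (hu : ‖u‖ = 1) (hw : ‖w‖ = 1) :
    crossForm a b u w ^ 2 ≤ ∑ i, ‖∑ k, ⟪a k, e i⟫ • b k‖ ^ 2 := by
  calc crossForm a b u w ^ 2
      ≤ (∑ i, ⟪e i, u⟫ ^ 2) * ∑ i, crossForm a b (e i) w ^ 2 := by
        rw [crossForm_eq_sum_orthonormalBasis e]
        exact Finset.sum_mul_sq_le_sq_mul_sq _ _ _
    _ = ∑ i, crossForm a b (e i) w ^ 2 := by rw [e.sum_sq_inner_right, hu, one_pow, one_mul]
    _ ≤ ∑ i, ‖∑ k, ⟪a k, e i⟫ • b k‖ ^ 2 := by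
        refine Finset.sum_le_sum fun i _ => sq_le_sq.2 ?_
        rw [crossForm_eq_inner, abs_norm]
        simpa [hw] using abs_real_inner_le_norm (∑ k, ⟪a k, e i⟫ • b k) w

variable [FiniteDimensional ℝ F] [MeasurableSpace F] [BorelSpace F]

/-- The square is linearized by an auxiliary standard Gaussian vector `x`. -/
lemma lintegral_eexp_normSq_sum {q : ℝ} (hq : 0 ≤ q) (c : K → ℝ) (hc : q * ∑ k, c k ^ 2 < 1) :
    ∫⁻ h, eexp (q / 2 * ‖∑ k, c k • h k‖ ^ 2) ∂(stdGaussianPi K F)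
      = eexp (-(Module.finrank ℝ F * Real.log (1 - q * ∑ k, c k ^ 2) / 2)) := by
  have hlinear : ∀ h : K → F, eexp (q / 2 * ‖∑ k, c k • h k‖ ^ 2)
      = ∫⁻ x, eexp (∑ k, ⟪(√q * c k) • x, h k⟫) ∂(stdGaussian F) := fun h => by
    have hsum : ∀ x : F, ∑ k, ⟪(√q * c k) • x, h k⟫ = ⟪√q • ∑ k, c k • h k, x⟫ := fun x => by
      rw [real_inner_comm]
      simp only [real_inner_smul_left, real_inner_smul_right, inner_sum, Finset.mul_sum, mul_assoc]
    simp only [hsum]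
    rw [lintegral_eexp_inner_stdGaussian, norm_smul, mul_pow, Real.norm_eq_abs, sq_abs,
      Real.sq_sqrt hq]
    ring_nf
  have hnorm : ∀ x : F, ∑ k, ‖(√q * c k) • x‖ ^ 2 / 2
      = q * (∑ k, c k ^ 2) / 2 * ‖x‖ ^ 2 := fun x => by
    simp only [norm_smul, mul_pow, Real.norm_eq_abs, sq_abs, Real.sq_sqrt hq, Finset.mul_sum,
      Finset.sum_div, Finset.sum_mul]
    exact Finset.sum_congr rfl fun k _ => by ring
  simp only [hlinear]
  rw [lintegral_lintegral_swap (by fun_prop)]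
  simp only [lintegral_eexp_sum_inner, hnorm]
  rw [lintegral_eexp_normSq_stdGaussian (by linarith)]
  ring_nf

lemma lintegral_eexp_sum_mul_normSq_sum_le {ι : Type*} [Fintype ι] {p : ι → ℝ} (hp : ∀ i, 0 ≤ p i)
    (hp1 : ∑ i, p i = 1) {c : ι → K → ℝ} (hc : ∀ i, ∑ k, c i k ^ 2 ≤ 1) {q : ℝ} (hq : 0 ≤ q)
    (hq1 : q < 1) :
    ∫⁻ h, eexp (∑ i, p i * (q / 2 * ‖∑ k, c i k • h k‖ ^ 2)) ∂(stdGaussianPi K F)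
      ≤ eexp (-(Module.finrank ℝ F * Real.log (1 - q) / 2)) := by
  have hterm : ∀ i, ∫⁻ h, eexp (q / 2 * ‖∑ k, c i k • h k‖ ^ 2) ∂(stdGaussianPi K F)
      ≤ eexp (-(Module.finrank ℝ F * Real.log (1 - q) / 2)) := fun i => by
    have hqc : q * ∑ k, c i k ^ 2 ≤ q := mul_le_of_le_one_right hq (hc i)
    rw [lintegral_eexp_normSq_sum hq (c i) (hqc.trans_lt hq1)]
    refine eexp_mono ?_
    have hlog : Real.log (1 - q) ≤ Real.log (1 - q * ∑ k, c i k ^ 2) :=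
      Real.log_le_log (by linarith) (by linarith)
    gcongr
  calc ∫⁻ h, eexp (∑ i, p i * (q / 2 * ‖∑ k, c i k • h k‖ ^ 2)) ∂(stdGaussianPi K F)
      ≤ ∫⁻ h, ∑ i, ENNReal.ofReal (p i) * eexp (q / 2 * ‖∑ k, c i k • h k‖ ^ 2)
          ∂(stdGaussianPi K F) := lintegral_mono fun h => eexp_sum_mul_le hp hp1 _
    _ = ∑ i, ENNReal.ofReal (p i) * ∫⁻ h, eexp (q / 2 * ‖∑ k, c i k • h k‖ ^ 2)
          ∂(stdGaussianPi K F) := by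
        rw [lintegral_finsetSum _ fun i _ => by fun_prop]
        exact Finset.sum_congr rfl fun i _ => lintegral_const_mul _ (by fun_prop)
    _ ≤ ∑ i, ENNReal.ofReal (p i) * eexp (-(Module.finrank ℝ F * Real.log (1 - q) / 2)) := by
        gcongr with i
        exact hterm i
    _ = eexp (-(Module.finrank ℝ F * Real.log (1 - q) / 2)) := by
        rw [← Finset.sum_mul, ← ENNReal.ofReal_sum_of_nonneg fun i _ => hp i, hp1,
          ENNReal.ofReal_one, one_mul]

lemma exists_normalized_rows {ι : Type*} (m : ι → K → ℝ) :
    ∃ c : ι → K → ℝ, (∀ i, ∑ k, c i k ^ 2 ≤ 1) ∧ ∀ i k, m i k = √(∑ k, m i k ^ 2) * c i k := by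
  refine ⟨fun i k => m i k / √(∑ k, m i k ^ 2), fun i => ?_, fun i k => ?_⟩
  · simp only [div_pow, Real.sq_sqrt (Finset.sum_nonneg fun k _ => sq_nonneg (m i k)),
      ← Finset.sum_div]
    exact div_self_le_one _
  · rcases eq_or_ne √(∑ k, m i k ^ 2) 0 with h | h
    · rw [h, zero_mul]
      rw [Real.sqrt_eq_zero (Finset.sum_nonneg fun k _ => sq_nonneg (m i k)),
        Finset.sum_eq_zero_iff_of_nonneg fun k _ => sq_nonneg (m i k)] at h
      exact pow_eq_zero_iff two_ne_zero |>.1 (h k (Finset.mem_univ k))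
    · rw [mul_div_cancel₀ _ h]

/-- Jensen's inequality over the rows of `m`, weighted by their squared norms. -/
lemma measure_lt_sum_normSq_sum {ι : Type*} [Fintype ι] (m : ι → K → ℝ) {q R : ℝ} (hq : 0 ≤ q)
    (hq1 : q < 1) :
    stdGaussianPi K F {h | (∑ i, ∑ k, m i k ^ 2) * R < ∑ i, ‖∑ k, m i k • h k‖ ^ 2}
      ≤ eexp (-(q * R / 2) - Module.finrank ℝ F * Real.log (1 - q) / 2) := by
  obtain ⟨c, hc, hmc⟩ := exists_normalized_rows m
  set s : ι → ℝ := fun i => ∑ k, m i k ^ 2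
  set S := ∑ i, s i
  have hs : ∀ i, 0 ≤ s i := fun i => Finset.sum_nonneg fun k _ => sq_nonneg _
  have hrow : ∀ i (h : K → F),
      ‖∑ k, m i k • h k‖ ^ 2 = s i * ‖∑ k, c i k • h k‖ ^ 2 := fun i h => by
    have hsmul : ∑ k, m i k • h k = √(s i) • ∑ k, c i k • h k := by
      rw [Finset.smul_sum]
      exact Finset.sum_congr rfl fun k _ => by rw [smul_smul, ← hmc]
    rw [hsmul, norm_smul, mul_pow, Real.norm_eq_abs, sq_abs, Real.sq_sqrt (hs i)]
  simp only [hrow]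
  have hS : 0 ≤ S := Finset.sum_nonneg fun i _ => hs i
  rcases hS.eq_or_lt with hS0 | hS0
  · have hs0 : ∀ i, s i = 0 := fun i =>
      (Finset.sum_eq_zero_iff_of_nonneg fun i _ => hs i).1 hS0.symm i (Finset.mem_univ i)
    simp [hs0, ← hS0]
  set f : (K → F) → ℝ := fun h => ∑ i, s i / S * (q / 2 * ‖∑ k, c i k • h k‖ ^ 2)
  have hf : ∀ h, f h = q / (2 * S) * ∑ i, s i * ‖∑ k, c i k • h k‖ ^ 2 := fun h => by
    simp only [f, Finset.mul_sum]
    exact Finset.sum_congr rfl fun i _ => by ring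
  have hp1 : ∑ i, s i / S = 1 := by rw [← Finset.sum_div]; exact div_self hS0.ne'
  rw [sub_eq_add_neg, eexp_add]
  calc stdGaussianPi K F {h | S * R < ∑ i, s i * ‖∑ k, c i k • h k‖ ^ 2}
      ≤ stdGaussianPi K F {h | q * R / 2 ≤ f h} := by
        refine measure_mono fun h (hh : S * R < _) => ?_
        have hscaled := mul_le_mul_of_nonneg_left hh.le (show 0 ≤ q / (2 * S) by positivity)
        rwa [← hf, show q / (2 * S) * (S * R) = q * R / 2 by field_simp] at hscaled
    _ ≤ eexp (-(q * R / 2)) * ∫⁻ h, eexp (f h) ∂(stdGaussianPi K F) :=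
        measure_le_eexp_neg_mul_lintegral _ (by fun_prop) _
    _ ≤ eexp (-(q * R / 2)) * eexp (-(Module.finrank ℝ F * Real.log (1 - q) / 2)) := by
        gcongr
        exact lintegral_eexp_sum_mul_normSq_sum_le (fun i => div_nonneg (hs i) hS) hp1 hc hq hq1

lemma measure_exists_lt_sq_crossForm [FiniteDimensional ℝ E] (a : K → E) {q R : ℝ} (hq : 0 ≤ q)
    (hq1 : q < 1) :
    stdGaussianPi K F {h | ∃ u w, ‖u‖ = 1 ∧ ‖w‖ = 1 ∧
        (∑ k, ‖a k‖ ^ 2) * R < crossForm a h u w ^ 2}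
      ≤ eexp (-(q * R / 2) - Module.finrank ℝ F * Real.log (1 - q) / 2) := by
  set e := stdOrthonormalBasis ℝ E
  have hnorm : ∑ i, ∑ k, ⟪a k, e i⟫ ^ 2 = ∑ k, ‖a k‖ ^ 2 := by
    rw [Finset.sum_comm]
    exact Finset.sum_congr rfl fun k _ => e.sum_sq_inner_left (a k)
  refine (measure_mono ?_).trans (measure_lt_sum_normSq_sum (fun i k => ⟪a k, e i⟫) hq hq1)
  rintro h ⟨u, w, hu, hw, hlt⟩
  rw [← hnorm] at hlt
  exact hlt.trans_le (sq_crossForm_le e a h hu hw)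

end DeterministicCross

lemma ball_one_sub_smul_subset {E : Type*} [NormedAddCommGroup E] [NormedSpace ℝ E] {u : E}
    (hu : ‖u‖ = 1) {ρ : ℝ} (hρ : ρ ≤ 1) :
    ball ((1 - ρ) • u) ρ ⊆ ball 0 1 :=
  ball_subset_ball' (by
    rw [dist_zero_right, norm_smul, hu, Real.norm_of_nonneg (sub_nonneg.2 hρ)]; linarith)

section GaussianCross

variable {E F K : Type*} [NormedAddCommGroup E] [InnerProductSpace ℝ E] [FiniteDimensional ℝ E]
  [MeasurableSpace E] [BorelSpace E] [NormedAddCommGroup F] [InnerProductSpace ℝ F]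
  [FiniteDimensional ℝ F] [MeasurableSpace F] [BorelSpace F] [Fintype K]

lemma volume_ball_mul_eexp_crossForm_le (a : K → E) (b : K → F) (θ : ℝ) (c : E) (c' : F) (r : ℝ) :
    volume (ball (0 : E) r ×ˢ ball (0 : F) r) * eexp (θ * crossForm a b c c')
      ≤ ∫⁻ z in ball c r ×ˢ ball c' r, eexp (θ * crossForm a b z.1 z.2) := by
  have hleft : ∀ v w, θ * crossForm a b v w = ⟪θ • ∑ k, ⟪b k, w⟫ • a k, v⟫ := fun v w => by
    rw [crossForm_comm, crossForm_eq_inner, real_inner_smul_left]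
  have hright : ∀ v w, θ * crossForm a b v w = ⟪θ • ∑ k, ⟪a k, v⟫ • b k, w⟫ := fun v w => by
    rw [crossForm_eq_inner, real_inner_smul_left]
  rw [Measure.volume_eq_prod, Measure.prod_prod, ← Measure.prod_restrict,
    lintegral_prod _ (by fun_prop)]
  calc volume (ball (0 : E) r) * volume (ball (0 : F) r) * eexp (θ * crossForm a b c c')
      = volume (ball (0 : F) r) * (volume (ball (0 : E) r) * eexp (θ * crossForm a b c c')) := by
        ring
    _ ≤ volume (ball (0 : F) r) * ∫⁻ v in ball c r, eexp (θ * crossForm a b v c') := by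
        gcongr
        simp only [hleft]
        exact volume_ball_mul_eexp_inner_le _ c r
    _ = ∫⁻ v in ball c r, volume (ball (0 : F) r) * eexp (θ * crossForm a b v c') :=
        (lintegral_const_mul _ (by fun_prop)).symm
    _ ≤ ∫⁻ v in ball c r, ∫⁻ w in ball c' r, eexp (θ * crossForm a b v w) := by
        refine lintegral_mono fun v => ?_
        simp only [hright v]
        exact volume_ball_mul_eexp_inner_le _ c' r

lemma volume_ball_one_prod_ball_one {ρ : ℝ} (hρ : 0 < ρ) :
    volume (ball (0 : E) 1 ×ˢ ball (0 : F) 1)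
      = eexp ((Module.finrank ℝ E + Module.finrank ℝ F) * Real.log (1 / ρ))
        * volume (ball (0 : E) ρ ×ˢ ball (0 : F) ρ) := by
  have hE := volume_ball_mul (E := E) (one_div_pos.2 hρ) ρ
  have hF := volume_ball_mul (E := F) (one_div_pos.2 hρ) ρ
  rw [one_div_mul_cancel hρ.ne'] at hE hF
  rw [Measure.volume_eq_prod, Measure.prod_prod, Measure.prod_prod, hE, hF, add_mul, eexp_add]
  ring

lemma measure_exists_lt_crossForm {θ ρ r : ℝ} (hθ : 0 ≤ θ) (hθ1 : θ ^ 2 < 1) (hρ : 0 < ρ)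
    (hρ1 : ρ ≤ 1) :
    (stdGaussianPi K E).prod (stdGaussianPi K F)
        {p | ∃ u w, ‖u‖ = 1 ∧ ‖w‖ = 1 ∧ r < crossForm p.1 p.2 u w}
      ≤ eexp (-(Fintype.card K * Real.log (1 - θ ^ 2) / 2)
          + (Module.finrank ℝ E + Module.finrank ℝ F) * Real.log (1 / ρ)
        - θ * ((1 - ρ) ^ 2 * r)) := by
  have hvol : volume (ball (0 : E) ρ ×ˢ ball (0 : F) ρ)
      = volume (ball (0 : E) ρ) * volume (ball (0 : F) ρ) := by
    rw [Measure.volume_eq_prod, Measure.prod_prod]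
  refine le_eexp_sub_of_mul_le (b := volume (ball (0 : E) ρ ×ˢ ball (0 : F) ρ)) ?_ ?_ ?_
  · rw [hvol]
    exact mul_ne_zero (measure_ball_pos volume _ hρ).ne' (measure_ball_pos volume _ hρ).ne'
  · rw [hvol]
    exact ENNReal.mul_ne_top measure_ball_lt_top.ne measure_ball_lt_top.ne
  rw [eexp_add, mul_assoc (eexp _) (eexp _), ← volume_ball_one_prod_ball_one hρ,
    ← Measure.restrict_apply_univ (ball (0 : E) 1 ×ˢ ball (0 : F) 1)]
  refine mul_measure_le_of_le_lintegral ((stdGaussianPi K E).prod (stdGaussianPi K F))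
    (volume.restrict (ball 0 1 ×ˢ ball 0 1))
    (f := fun (p : (K → E) × (K → F)) z => eexp (θ * crossForm p.1 p.2 z.1 z.2))
    (by unfold Function.uncurry; fun_prop) ?_
    (ae_restrict_of_forall_mem (measurableSet_ball.prod measurableSet_ball) fun z hz =>
      lintegral_eexp_crossForm_le hθ1 (mem_ball_zero_iff.1 hz.1).le (mem_ball_zero_iff.1 hz.2).le)
  rintro ⟨g, h⟩ ⟨u, w, hu, hw, hlt⟩
  calc volume (ball (0 : E) ρ ×ˢ ball (0 : F) ρ) * eexp (θ * ((1 - ρ) ^ 2 * r))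
      ≤ volume (ball (0 : E) ρ ×ˢ ball (0 : F) ρ)
          * eexp (θ * crossForm g h ((1 - ρ) • u) ((1 - ρ) • w)) := by
        rw [crossForm_smul_smul, ← sq]
        gcongr
        exact eexp_mono (by gcongr)
    _ ≤ ∫⁻ z in ball ((1 - ρ) • u) ρ ×ˢ ball ((1 - ρ) • w) ρ, eexp (θ * crossForm g h z.1 z.2) :=
        volume_ball_mul_eexp_crossForm_le g h θ _ _ ρ
    _ ≤ ∫⁻ z in ball 0 1 ×ˢ ball 0 1, eexp (θ * crossForm g h z.1 z.2) :=
        lintegral_mono_set (Set.prod_mono (ball_one_sub_smul_subset hu hρ1)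
          (ball_one_sub_smul_subset hw hρ1))

end GaussianCross

section Matrices

variable {ι κ K : Type*} [Fintype K]

/-- The cross matrix `∑ₖ bₖ aₖ*` of two finite families of vectors; `crossSum` is the case of
families indexed by agents and times. -/
def crossMatrix (b : K → EuclideanSpace ℝ κ) (a : K → EuclideanSpace ℝ ι) : Matrix κ ι ℝ :=
  ∑ k, Matrix.vecMulVec (b k).ofLp (a k).ofLp

lemma isHermitian_crossMatrix_self (a : K → EuclideanSpace ℝ ι) :
    (crossMatrix a a).IsHermitian := by
  ext i j
  simp [crossMatrix, Matrix.sum_apply, Matrix.vecMulVec_apply, mul_comm]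

variable [Fintype ι] [Fintype κ] [DecidableEq ι]

lemma inner_toEuclideanLin_crossMatrix (b : K → EuclideanSpace ℝ κ)
    (a : K → EuclideanSpace ℝ ι) (u : EuclideanSpace ℝ ι) (w : EuclideanSpace ℝ κ) :
    ⟪Matrix.toEuclideanLin (crossMatrix b a) u, w⟫ = crossForm a b u w := by
  rw [crossMatrix, map_sum, LinearMap.sum_apply, crossForm_eq_inner]
  congr! 2 with k
  ext i
  simp [Matrix.toLpLin_apply, Matrix.vecMulVec_mulVec, EuclideanSpace.inner_eq_star_dotProduct,
    dotProduct_comm]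

lemma l2_opNorm_le_of_inner_le (A : Matrix κ ι ℝ) {r : ℝ} (hr : 0 ≤ r)
    (h : ∀ u w, ‖u‖ = 1 → ‖w‖ = 1 → ⟪Matrix.toEuclideanLin A u, w⟫ ≤ r) : ‖A‖ ≤ r := by
  rw [Matrix.l2_opNorm_def]
  exact ContinuousLinearMap.opNorm_le_of_re_inner_le hr h

lemma mul_norm_le_norm_toEuclideanLin {S : Matrix ι ι ℝ} {c : ℝ}
    (h : ∀ u, c * ‖u‖ ^ 2 ≤ ⟪Matrix.toEuclideanLin S u, u⟫) (u : EuclideanSpace ℝ ι) :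
    c * ‖u‖ ≤ ‖Matrix.toEuclideanLin S u‖ := by
  rcases eq_or_ne u 0 with rfl | hu
  · simp
  refine le_of_mul_le_mul_right ?_ (norm_pos_iff.2 hu)
  rw [mul_assoc, ← sq]
  exact (h u).trans (real_inner_le_norm _ _)

lemma isUnit_of_mul_normSq_le_inner {S : Matrix ι ι ℝ} {c : ℝ} (hc : 0 < c)
    (h : ∀ u, c * ‖u‖ ^ 2 ≤ ⟪Matrix.toEuclideanLin S u, u⟫) : IsUnit S := by
  rw [← isUnit_map_iff (Matrix.toLpLinAlgEquiv 2), LinearMap.isUnit_iff_ker_eq_bot,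
    LinearMap.ker_eq_bot']
  intro u hu
  have hnorm := mul_norm_le_norm_toEuclideanLin h u
  rw [show Matrix.toEuclideanLin S u = 0 from hu, norm_zero] at hnorm
  exact norm_le_zero_iff.1 (nonpos_of_mul_nonpos_right hnorm hc)

lemma l2_opNorm_inv_le {S : Matrix ι ι ℝ} {c : ℝ} (hc : 0 < c)
    (h : ∀ u, c * ‖u‖ ^ 2 ≤ ⟪Matrix.toEuclideanLin S u, u⟫) : ‖S⁻¹‖ ≤ c⁻¹ := by
  have hdet := (Matrix.isUnit_iff_isUnit_det S).1 (isUnit_of_mul_normSq_le_inner hc h)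
  rw [Matrix.l2_opNorm_def]
  refine ContinuousLinearMap.opNorm_le_bound _ (by positivity) fun v => ?_
  have hcancel : Matrix.toEuclideanLin S (Matrix.toEuclideanLin S⁻¹ v) = v := by
    rw [← LinearMap.comp_apply, ← Matrix.toLpLin_mul_same, Matrix.mul_nonsing_inv S hdet,
      Matrix.toLpLin_one, LinearMap.id_apply]
  have hnorm := mul_norm_le_norm_toEuclideanLin h (Matrix.toEuclideanLin S⁻¹ v)
  rw [hcancel, ← le_div_iff₀' hc, div_eq_inv_mul] at hnorm
  exact hnorm

end Matrices

section LambdaMin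

variable {n : ℕ}

open scoped MatrixOrder in
lemma le_lambdaMin_iff (hn : 0 < n) {A : Matrix (Fin n) (Fin n) ℝ} (hA : A.IsHermitian) (c : ℝ) :
    c ≤ lambdaMin A ↔ ∀ u, c * ‖u‖ ^ 2 ≤ ⟪Matrix.toEuclideanLin A u, u⟫ := by
  have hne : (spectrum ℝ A).Nonempty := ⟨_, hA.eigenvalues_mem_spectrum_real ⟨0, hn⟩⟩
  have hbdd : BddBelow (spectrum ℝ A) := (Matrix.finite_real_spectrum (A := A)).bddBelow
  have hsymm : (A - algebraMap ℝ _ c).IsHermitian :=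
    hA.sub (IsSelfAdjoint.algebraMap _ (.all c))
  rw [lambdaMin, le_csInf_iff hbdd hne, ← algebraMap_le_iff_le_spectrum (a := A) (r := c) hA,
    Matrix.le_iff, ← Matrix.isPositive_toEuclideanLin_iff, LinearMap.isPositive_iff,
    Matrix.isSymmetric_toEuclideanLin_iff, and_iff_right hsymm]
  refine forall_congr' fun u => ?_
  rw [map_sub, LinearMap.sub_apply, inner_sub_left, Algebra.algebraMap_eq_smul_one, map_smul,
    Matrix.toLpLin_one, LinearMap.smul_apply, LinearMap.id_apply, real_inner_smul_left,
    real_inner_self_eq_norm_sq, sub_nonneg]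

variable {K : Type*} [Fintype K]

lemma isHermitian_one_add_smul_crossMatrix (c : ℝ) (a : K → EuclideanSpace ℝ (Fin n)) :
    (1 + c • crossMatrix a a).IsHermitian :=
  Matrix.isHermitian_one.add ((isHermitian_crossMatrix_self a).smul (.all c))

lemma inner_toEuclideanLin_one_add_smul_crossMatrix (c : ℝ) (a : K → EuclideanSpace ℝ (Fin n))
    (u : EuclideanSpace ℝ (Fin n)) :
    ⟪Matrix.toEuclideanLin (1 + c • crossMatrix a a) u, u⟫ = ‖u‖ ^ 2 + c * crossForm a a u u := by
  rw [map_add, map_smul, Matrix.toLpLin_one, LinearMap.add_apply, LinearMap.smul_apply,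
    LinearMap.id_apply, inner_add_left, real_inner_smul_left, inner_toEuclideanLin_crossMatrix,
    real_inner_self_eq_norm_sq]

lemma one_le_lambdaMin_one_add_smul_crossMatrix (hn : 0 < n) {c : ℝ} (hc : 0 ≤ c)
    (a : K → EuclideanSpace ℝ (Fin n)) : 1 ≤ lambdaMin (1 + c • crossMatrix a a) := by
  refine (le_lambdaMin_iff hn (isHermitian_one_add_smul_crossMatrix c a) 1).2 fun u => ?_
  rw [inner_toEuclideanLin_one_add_smul_crossMatrix, one_mul]
  exact le_add_of_nonneg_right (mul_nonneg hc (crossForm_self_nonneg a u))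

end LambdaMin

section LeastSquares

variable {E F K : Type*} [NormedAddCommGroup E] [InnerProductSpace ℝ E] [NormedAddCommGroup F]
  [InnerProductSpace ℝ F] [Fintype K]

/-- The features and noises for which the Gram matrix of the features is at least `c` and the cross
matrix of noises and features has norm at most `r`. -/
def goodSamples (K E F : Type*) [NormedAddCommGroup E] [InnerProductSpace ℝ E]
    [NormedAddCommGroup F] [InnerProductSpace ℝ F] [Fintype K] (c r : ℝ) :
    Set ((K → E) × (K → F)) :=
  {q | (∀ u, ‖u‖ = 1 → c ≤ crossForm q.1 q.1 u u) ∧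
    ∀ u w, ‖u‖ = 1 → ‖w‖ = 1 → crossForm q.1 q.2 u w ≤ r}

lemma isClosed_goodSamples (c r : ℝ) : IsClosed (goodSamples K E F c r) := by
  simp only [goodSamples, Set.ofPred_and, Set.ofPred_forall]
  refine IsClosed.inter ?_ ?_
  · exact isClosed_iInter fun u => isClosed_iInter fun _ => isClosed_le (by fun_prop) (by fun_prop)
  · exact isClosed_iInter fun u => isClosed_iInter fun w => isClosed_iInter fun _ =>
      isClosed_iInter fun _ => isClosed_le (by fun_prop) (by fun_prop)

lemma mul_normSq_le_crossForm_self {a : K → E} {c : ℝ}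
    (h : ∀ u, ‖u‖ = 1 → c ≤ crossForm a a u u) (u : E) : c * ‖u‖ ^ 2 ≤ crossForm a a u u := by
  rcases eq_or_ne u 0 with rfl | hu
  · simp [crossForm]
  have hunit := h (‖u‖⁻¹ • u) (norm_smul_inv_norm hu)
  have hpos : 0 < ‖u‖ := norm_pos_iff.2 hu
  rw [crossForm_smul_smul, ← mul_inv, ← sq, inv_mul_eq_div] at hunit
  exact (le_div_iff₀ (by positivity)).1 hunit

variable {ι κ : Type*} [Fintype ι] [DecidableEq ι]

lemma crossMatrix_toEuclideanLin_add (Θ : Matrix κ ι ℝ) (a : K → EuclideanSpace ℝ ι)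
    (b : K → EuclideanSpace ℝ κ) :
    crossMatrix (fun k => Matrix.toEuclideanLin Θ (a k) + b k) a
      = Θ * crossMatrix a a + crossMatrix b a := by
  simp only [crossMatrix, Matrix.mul_sum, ← Finset.sum_add_distrib]
  refine Finset.sum_congr rfl fun k _ => ?_
  rw [Matrix.mul_vecMulVec, ← Matrix.add_vecMulVec]
  rfl

variable [Fintype κ]

lemma isUnit_crossMatrix_of_mem_goodSamples {c r : ℝ} (hc : 0 < c)
    {q : (K → EuclideanSpace ℝ ι) × (K → EuclideanSpace ℝ κ)} (hq : q ∈ goodSamples K _ _ c r) :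
    IsUnit (crossMatrix q.1 q.1) :=
  isUnit_of_mul_normSq_le_inner hc fun u => by
    rw [inner_toEuclideanLin_crossMatrix]
    exact mul_normSq_le_crossForm_self hq.1 u

lemma norm_leastSquares_sub_le {c r : ℝ} (hc : 0 < c) (hr : 0 ≤ r)
    {q : (K → EuclideanSpace ℝ ι) × (K → EuclideanSpace ℝ κ)} (hq : q ∈ goodSamples K _ _ c r)
    (Θ : Matrix κ ι ℝ) :
    ‖crossMatrix (fun k => Matrix.toEuclideanLin Θ (q.1 k) + q.2 k) q.1 * (crossMatrix q.1 q.1)⁻¹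
      - Θ‖ ≤ r / c := by
  have hinv : ‖(crossMatrix q.1 q.1)⁻¹‖ ≤ c⁻¹ := l2_opNorm_inv_le hc fun u => by
    rw [inner_toEuclideanLin_crossMatrix]
    exact mul_normSq_le_crossForm_self hq.1 u
  have hcross : ‖crossMatrix q.2 q.1‖ ≤ r := l2_opNorm_le_of_inner_le _ hr fun u w hu hw => by
    rw [inner_toEuclideanLin_crossMatrix]
    exact hq.2 u w hu hw
  have hdet := (Matrix.isUnit_iff_isUnit_det _).1 (isUnit_crossMatrix_of_mem_goodSamples hc hq)
  rw [crossMatrix_toEuclideanLin_add, Matrix.add_mul, Matrix.mul_assoc,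
    Matrix.mul_nonsing_inv _ hdet, Matrix.mul_one, add_sub_cancel_left]
  calc ‖crossMatrix q.2 q.1 * (crossMatrix q.1 q.1)⁻¹‖
      ≤ ‖crossMatrix q.2 q.1‖ * ‖(crossMatrix q.1 q.1)⁻¹‖ := Matrix.l2_opNorm_mul _ _
    _ ≤ r * c⁻¹ := by gcongr
    _ = r / c := (div_eq_mul_inv r c).symm

end LeastSquares

section AffineSamples

variable {E F K : Type*} [NormedAddCommGroup E] [InnerProductSpace ℝ E] [NormedAddCommGroup F]
  [InnerProductSpace ℝ F]

/-- The map carrying families of standard Gaussian vectors to features with means `μ` and standard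
deviation `σ`, and centered noises with standard deviation `σ'`. -/
def affineSamples (μ : K → E) (σ σ' : ℝ) (p : (K → E) × (K → F)) : (K → E) × (K → F) :=
  (μ + σ • p.1, σ' • p.2)

@[fun_prop]
lemma measurable_affineSamples [MeasurableSpace E] [BorelSpace E] [SecondCountableTopology E]
    [MeasurableSpace F] [BorelSpace F] [SecondCountableTopology F] (μ : K → E) (σ σ' : ℝ) :
    Measurable (affineSamples μ σ σ' : (K → E) × (K → F) → _) := by
  unfold affineSamples; fun_prop

variable [Fintype K]

lemma crossForm_add_smul_self (μ g : K → E) (σ : ℝ) (u : E) :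
    crossForm (μ + σ • g) (μ + σ • g) u u
      = crossForm μ μ u u + 2 * σ * crossForm μ g u u + σ ^ 2 * crossForm g g u u := by
  simp only [crossForm, Pi.add_apply, Pi.smul_apply, inner_add_left, real_inner_smul_left,
    Finset.mul_sum, ← Finset.sum_add_distrib]
  exact Finset.sum_congr rfl fun k _ => by ring

lemma crossForm_add_smul_smul (μ g : K → E) (h : K → F) (σ σ' : ℝ) (u : E) (w : F) :
    crossForm (μ + σ • g) (σ' • h) u w
      = σ' * (σ * crossForm g h u w + crossForm μ h u w) := by
  simp only [crossForm, Pi.add_apply, Pi.smul_apply, inner_add_left, real_inner_smul_left,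
    Finset.mul_sum, ← Finset.sum_add_distrib]
  exact Finset.sum_congr rfl fun k _ => by ring

lemma affineSamples_mem_goodSamples {μ : K → E} {σ σ' : ℝ} (hσ : 0 ≤ σ) (hσ' : 0 ≤ σ')
    {p : (K → E) × (K → F)} {α β r s : ℝ}
    (hgram : ∀ u, ‖u‖ = 1 → α ≤ crossForm p.1 p.1 u u)
    (hfeature : ∀ u, ‖u‖ = 1 → |crossForm μ p.1 u u| ≤ β)
    (hgauss : ∀ u w, ‖u‖ = 1 → ‖w‖ = 1 → crossForm p.1 p.2 u w ≤ r)
    (hnoise : ∀ u w, ‖u‖ = 1 → ‖w‖ = 1 → crossForm μ p.2 u w ≤ s) {c : ℝ}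
    (hc : ∀ u, ‖u‖ = 1 → c ≤ crossForm μ μ u u - 2 * σ * β + σ ^ 2 * α) :
    affineSamples μ σ σ' p ∈ goodSamples K E F c (σ' * (σ * r + s)) := by
  refine ⟨fun u hu => (hc u hu).trans ?_, fun u w hu hw => ?_⟩
  · have hlin := mul_le_mul_of_nonneg_left (neg_le_of_abs_le (hfeature u hu)) hσ
    have hquad := mul_le_mul_of_nonneg_left (hgram u hu) (sq_nonneg σ)
    rw [affineSamples, crossForm_add_smul_self]
    linarith
  · rw [affineSamples, crossForm_add_smul_smul]
    gcongr
    exacts [hgauss u w hu hw, hnoise u w hu hw]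

end AffineSamples

section Thresholds

lemma sum_normSq_le_card_mul_sq {E K : Type*} [NormedAddCommGroup E] [Fintype K] {μ : K → E}
    {ν : ℝ} (hμ : ∀ k, ‖μ k‖ ≤ ν) : ∑ k, ‖μ k‖ ^ 2 ≤ Fintype.card K * ν ^ 2 := by
  rw [← nsmul_eq_mul, Fintype.card]
  exact Finset.sum_le_card_nsmul _ _ _ fun k _ => pow_le_pow_left₀ (norm_nonneg _) (hμ k) 2

lemma add_le_sq_sqrt_add {a b c : ℝ} (ha : 0 ≤ a) (hb : 0 ≤ b) (hc : 0 ≤ c) :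
    a + c ^ 2 * b ≤ (√a + c * √b) ^ 2 := by
  have hmixed : 0 ≤ c * (√a * √b) := by positivity
  rw [add_sq, mul_pow, Real.sq_sqrt ha, Real.sq_sqrt hb]
  linarith

lemma neg_log_half_pow_le (j : ℕ) : -Real.log ((1 / 2) ^ j) ≤ j := by
  rw [Real.log_pow, one_div, Real.log_inv, mul_neg, neg_neg]
  exact mul_le_of_le_one_right (Nat.cast_nonneg j) (by linarith [Real.log_two_lt_d9])

variable {δ : ℝ}

lemma one_le_log_one_div (hδ : 0 < δ) (hδ4 : δ < 1 / 4) : 1 ≤ Real.log (1 / δ) := by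
  rw [Real.le_log_iff_exp_le (by positivity), le_div_iff₀ hδ]
  nlinarith [Real.exp_one_lt_d9]

lemma log_one_div_add_two_le (hδ : 0 < δ) : Real.log (1 / δ) + 2 ≤ Real.log (9 / δ) := by
  have hnine := le_mul_log_of_le_pow (x := 9) (p := 2) (q := 1) (by norm_num)
  rw [Real.log_div one_ne_zero hδ.ne', Real.log_div (by norm_num) hδ.ne', Real.log_one]
  norm_num at hnine
  linarith

lemma log_two_div_nonneg (hδ : 0 < δ) (hδ4 : δ < 1 / 4) : 0 ≤ Real.log (2 / δ) :=
  Real.log_nonneg (by rw [le_div_iff₀ hδ]; linarith)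

lemma mul_sq_mul_le_of_t2_le {n : ℕ} {N σ ν : ℝ} (hσ : 0 < σ) (hL : 0 ≤ Real.log (2 / δ))
    (h : t2 n σ ν δ ≤ N) : 256 * ν ^ 2 * (4 * n + 2 * Real.log (2 / δ)) ≤ N * σ ^ 2 := by
  rw [t2, div_pow, div_le_iff₀ (by positivity)] at h
  refine le_trans ?_ h
  have hsqrt := add_le_sq_sqrt_add (a := 4 * n) (b := 2 * Real.log (2 / δ)) (c := 1)
    (by positivity) (by positivity) zero_le_one
  simp only [one_pow, one_mul] at hsqrt
  rw [mul_pow]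
  calc 256 * ν ^ 2 * (4 * n + 2 * Real.log (2 / δ))
      = (16 * ν) ^ 2 * (4 * n + 2 * Real.log (2 / δ)) := by ring
    _ ≤ _ := by gcongr

lemma sqrt_mul_C1_div (n l : ℕ) (σ σ' ν : ℝ) {N : ℝ} (hN : 0 ≤ N) :
    √N * C1 n l σ σ' ν δ / 8 = σ' * (σ * (4 * √(N * (n + l) * Real.log (9 / δ)))
      + √N * (ν * (√(2 * (l + n)) + 2 * √(Real.log (2 / δ))))) := by
  rw [C1, mul_assoc N, Real.sqrt_mul hN]
  ring

/-- The logarithm of `4` is the cost of averaging over balls of radius `1 / 4`. -/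
lemma four_thirds_mul_add_log_four_le {a b : ℝ} (ha : 1 ≤ a) (hb : a + 2 ≤ b) :
    4 / 3 * a + Real.log 4 ≤ 9 / 4 * √(a * b / 2) := by
  have hlog := mul_log_le_of_pow_le (x := 4) (p := 7) (q := 5) (by norm_num) (by norm_num)
  have hsqrt : 4 / 9 * (4 / 3 * a + 7 / 5) ≤ √(a * b / 2) := by
    apply Real.le_sqrt_of_sq_le
    nlinarith [mul_le_mul_of_nonneg_left hb (zero_le_one.trans ha)]
  norm_num at hlog
  linarith

lemma neg_log_one_sub_le {x : ℝ} (hx : 0 ≤ x) (hx4 : x ≤ 1 / 4) :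
    -Real.log (1 - x) ≤ 4 / 3 * x := by
  have hlog := Real.one_sub_inv_le_log_of_pos (x := 1 - x) (by linarith)
  have hinv : (1 - x)⁻¹ ≤ 1 + 4 / 3 * x := by
    rw [inv_le_iff_one_le_mul₀ (by linarith)]
    nlinarith
  linarith

/-- The exponent of `measure_exists_lt_crossForm` for `θ = √(D * a / (2 * N))` and `ρ = 1 / 4`. -/
lemma crossForm_exponent_le {N D a b : ℝ} (hD : 1 ≤ D) (ha : 1 ≤ a) (hb : a + 2 ≤ b)
    (hN : 2 * D * a ≤ N) :
    -(N * Real.log (1 - √(D * a / (2 * N)) ^ 2) / 2) + D * Real.log 4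
      - √(D * a / (2 * N)) * (9 / 16 * (4 * √(N * D * b))) ≤ -a := by
  have hD0 : 0 < D := zero_lt_one.trans_le hD
  have hN0 : 0 < N := by nlinarith
  set x := D * a / (2 * N) with hx
  have hx0 : 0 ≤ x := by positivity
  have hx4 : x ≤ 1 / 4 := by rw [hx, div_le_iff₀ (by positivity)]; linarith
  have hNx : N * x = D * a / 2 := by rw [hx]; field_simp
  have hsqrt : √x * √(N * D * b) = D * √(a * b / 2) := by
    rw [← Real.sqrt_mul hx0, ← mul_assoc, ← mul_assoc, mul_comm x, hNx,
      show D * a / 2 * D * b = D ^ 2 * (a * b / 2) by ring, Real.sqrt_mul (by positivity),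
      Real.sqrt_sq hD0.le]
  have hlog := mul_le_mul_of_nonneg_left (neg_log_one_sub_le hx0 hx4) hN0.le
  have hgain := mul_le_mul_of_nonneg_left (four_thirds_mul_add_log_four_le ha hb) hD0.le
  have hDa := mul_le_mul_of_nonneg_right hD (zero_le_one.trans ha)
  rw [Real.sq_sqrt hx0]
  linear_combination hlog / 2 + hgain + hDa + 2 / 3 * hNx - 9 / 4 * hsqrt

end Thresholds

section FailureProbability

variable {E F K : Type*} [NormedAddCommGroup E] [InnerProductSpace ℝ E] [FiniteDimensional ℝ E]
  [NormedAddCommGroup F] [InnerProductSpace ℝ F] [FiniteDimensional ℝ F] [MeasurableSpace F]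
  [BorelSpace F] [Fintype K]

lemma measure_exists_pow_lt_sq_crossForm (a : K → E) (j : ℕ) {q : ℝ} (hq : 0 < q)
    (hqj : 1 - q = (1 / 2) ^ j) (L : ℝ) :
    stdGaussianPi K F {h | ∃ u w, ‖u‖ = 1 ∧ ‖w‖ = 1 ∧
        (∑ k, ‖a k‖ ^ 2) * ((j * Module.finrank ℝ F + 2 * L) / q) < crossForm a h u w ^ 2}
      ≤ eexp (-L) := by
  have hq1 : q < 1 := sub_pos.1 (hqj.symm ▸ by positivity)
  refine (measure_exists_lt_sq_crossForm a hq.le hq1).trans (eexp_mono ?_)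
  have hlog := neg_log_half_pow_le j
  rw [← hqj] at hlog
  rw [mul_div_cancel₀ _ hq.ne']
  linarith [mul_le_mul_of_nonneg_right hlog (Nat.cast_nonneg (α := ℝ) (Module.finrank ℝ F))]

lemma measure_exists_sqrt_mul_lt_crossForm {ν L : ℝ} (hν : 0 ≤ ν) {μ : K → E}
    (hμ : ∀ k, ‖μ k‖ ≤ ν) (hL : 0 ≤ L) :
    stdGaussianPi K F {h | ∃ u w, ‖u‖ = 1 ∧ ‖w‖ = 1 ∧
        √(Fintype.card K) * (ν * (√(2 * (Module.finrank ℝ F + Module.finrank ℝ E)) + 2 * √L))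
          < crossForm μ h u w}
      ≤ eexp (-L) := by
  set N := (Fintype.card K : ℝ)
  set d := (Module.finrank ℝ E : ℝ)
  set l := (Module.finrank ℝ F : ℝ)
  have hd : 0 ≤ d := Nat.cast_nonneg _
  refine le_trans (measure_mono ?_)
    (measure_exists_pow_lt_sq_crossForm (F := F) μ 1 (q := 1 / 2) (by norm_num) (by norm_num) L)
  rintro h ⟨u, w, hu, hw, hlt⟩
  refine ⟨u, w, hu, hw, ?_⟩
  have hsqrt := add_le_sq_sqrt_add (a := 2 * (l + d)) (by positivity) hL zero_le_two
  calc (∑ k, ‖μ k‖ ^ 2) * (((1 : ℕ) * l + 2 * L) / (1 / 2))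
      ≤ N * ν ^ 2 * (2 * (l + d) + 2 ^ 2 * L) := by
        gcongr
        · exact sum_normSq_le_card_mul_sq hμ
        · push_cast; linarith
    _ ≤ N * ν ^ 2 * (√(2 * (l + d)) + 2 * √L) ^ 2 := by gcongr
    _ = (√N * (ν * (√(2 * (l + d)) + 2 * √L))) ^ 2 := by
        rw [mul_pow, mul_pow, Real.sq_sqrt (Nat.cast_nonneg _), mul_assoc]
    _ < crossForm μ h u w ^ 2 := by gcongr

variable [MeasurableSpace E] [BorelSpace E]

lemma measure_exists_lt_abs_crossForm {σ ν L : ℝ} (hσ : 0 ≤ σ) {μ : K → E} (hμ : ∀ k, ‖μ k‖ ≤ ν)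
    (hL : 0 ≤ L) (hN : 256 * ν ^ 2 * (4 * Module.finrank ℝ E + 2 * L) ≤ Fintype.card K * σ ^ 2) :
    stdGaussianPi K E
        {g | ∃ u, ‖u‖ = 1 ∧ 13 / 200 * (Fintype.card K * σ) < |crossForm μ g u u|}
      ≤ eexp (-L) := by
  set N := (Fintype.card K : ℝ)
  set d := (Module.finrank ℝ E : ℝ)
  refine le_trans (measure_mono ?_)
    (measure_exists_pow_lt_sq_crossForm (F := E) μ 4 (q := 15 / 16) (by norm_num) (by norm_num) L)
  rintro g ⟨u, hu, hlt⟩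
  refine ⟨u, u, hu, hu, ?_⟩
  calc (∑ k, ‖μ k‖ ^ 2) * (((4 : ℕ) * d + 2 * L) / (15 / 16))
      ≤ N * ν ^ 2 * (((4 : ℕ) * d + 2 * L) / (15 / 16)) := by
        gcongr; exact sum_normSq_le_card_mul_sq hμ
    _ = N / 240 * (256 * ν ^ 2 * (4 * d + 2 * L)) := by push_cast; ring
    _ ≤ N / 240 * (N * σ ^ 2) := by gcongr
    _ ≤ (13 / 200 * (N * σ)) ^ 2 := by nlinarith [sq_nonneg (N * σ)]
    _ < |crossForm μ g u u| ^ 2 := by gcongr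
    _ = crossForm μ g u u ^ 2 := sq_abs _

variable {δ : ℝ}

lemma measure_exists_four_mul_sqrt_lt_crossForm [Nontrivial E] (hδ : 0 < δ) (hδ4 : δ < 1 / 4)
    (hN : t3 (Module.finrank ℝ E) (Module.finrank ℝ F) δ ≤ Fintype.card K) :
    (stdGaussianPi K E).prod (stdGaussianPi K F) {p | ∃ u w, ‖u‖ = 1 ∧ ‖w‖ = 1 ∧
        4 * √(Fintype.card K * (Module.finrank ℝ E + Module.finrank ℝ F) * Real.log (9 / δ))
          < crossForm p.1 p.2 u w}
      ≤ ENNReal.ofReal δ := by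
  set N := (Fintype.card K : ℝ)
  set D := (Module.finrank ℝ E : ℝ) + Module.finrank ℝ F
  set a := Real.log (1 / δ)
  have ha : 1 ≤ a := one_le_log_one_div hδ hδ4
  have hD : 1 ≤ D := le_add_of_le_of_nonneg (Nat.one_le_cast.2 Module.finrank_pos) (by positivity)
  have hN0 : 0 < N := lt_of_lt_of_le (by rw [t3]; positivity) hN
  have hθ : √(D * a / (2 * N)) ^ 2 < 1 := by
    rw [Real.sq_sqrt (by positivity), div_lt_one (by positivity)]
    rw [t3] at hN
    nlinarith
  refine (measure_exists_lt_crossForm (Real.sqrt_nonneg _) hθ (ρ := 1 / 4) (by norm_num)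
    (by norm_num)).trans ?_
  have hea : ENNReal.ofReal δ = eexp (-a) := by
    rw [eexp_neg_log (by positivity), one_div, inv_inv]
  rw [hea]
  refine eexp_mono ((le_of_eq ?_).trans
    (crossForm_exponent_le hD ha (log_one_div_add_two_le hδ) hN))
  norm_num [N, D]

/-- The constants of the Gram and feature bounds combine as `51 / 200 - 2 * (13 / 200) = 1 / 8`. -/
lemma measure_affineSamples_notMem_goodSamples_le [Nontrivial E] {σ σ' ν : ℝ} (hσ : 0 < σ)
    (hσ' : 0 ≤ σ') (hν : 0 ≤ ν) {μ : K → E} (hμ : ∀ k, ‖μ k‖ ≤ ν) (hδ : 0 < δ) (hδ4 : δ < 1 / 4)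
    (h₁ : t1 (Module.finrank ℝ E) δ ≤ Fintype.card K)
    (h₂ : t2 (Module.finrank ℝ E) σ ν δ ≤ Fintype.card K)
    (h₃ : t3 (Module.finrank ℝ E) (Module.finrank ℝ F) δ ≤ Fintype.card K) {c : ℝ}
    (hc : ∀ u, ‖u‖ = 1 → c ≤ Fintype.card K * σ ^ 2 / 8 + crossForm μ μ u u) :
    (stdGaussianPi K E).prod (stdGaussianPi K F) {p | affineSamples μ σ σ' p ∉
        goodSamples K E F c (√(Fintype.card K)
          * C1 (Module.finrank ℝ E) (Module.finrank ℝ F) σ σ' ν δ / 8)}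
      ≤ ENNReal.ofReal (4 * δ) := by
  set N := (Fintype.card K : ℝ)
  set L := Real.log (2 / δ)
  have hL : 0 ≤ L := log_two_div_nonneg hδ hδ4
  have heL : eexp (-L) = ENNReal.ofReal (δ / 2) := by
    rw [eexp_neg_log (by positivity), inv_div]
  have hgram := measure_exists_crossForm_self_lt (E := E) (K := K) hL h₁
  have hfeature := measure_exists_lt_abs_crossForm hσ.le hμ hL (mul_sq_mul_le_of_t2_le hσ hL h₂)
  have hnoise := measure_exists_sqrt_mul_lt_crossForm (F := F) hν hμ hL
  have hgauss := measure_exists_four_mul_sqrt_lt_crossForm (F := F) (K := K) hδ hδ4 h₃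
  rw [sqrt_mul_C1_div _ _ _ _ _ (Nat.cast_nonneg _)]
  calc _ ≤ (stdGaussianPi K E).prod (stdGaussianPi K F) (Prod.fst ⁻¹' _ ∪ Prod.fst ⁻¹' _
        ∪ Prod.snd ⁻¹' _ ∪ _) := measure_mono ?_
    _ ≤ _ := (measure_union_le _ _).trans <| add_le_add ((measure_union_le _ _).trans <|
        add_le_add ((measure_union_le _ _).trans <| add_le_add
          ((measurePreserving_fst.measure_preimage_le _).trans hgram)
          ((measurePreserving_fst.measure_preimage_le _).trans hfeature))
          ((measurePreserving_snd.measure_preimage_le _).trans hnoise)) hgauss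
    _ ≤ ENNReal.ofReal (4 * δ) := by
        rw [heL, ← ENNReal.ofReal_ofNat 2, ← ENNReal.ofReal_mul zero_le_two, ← ENNReal.ofReal_add,
          ← ENNReal.ofReal_add, ← ENNReal.ofReal_add]
        · apply ENNReal.ofReal_le_ofReal; linarith
        all_goals positivity
  intro p hp
  contrapose! hp
  simp only [Set.mem_union, Set.mem_preimage, Set.mem_ofPred_eq, not_or, not_exists, not_and,
    not_lt] at hp ⊢
  obtain ⟨⟨⟨hp₁, hp₂⟩, hp₃⟩, hp₄⟩ := hp
  rw [not_not]
  exact affineSamples_mem_goodSamples hσ.le hσ' hp₁ hp₂ hp₄ hp₃ fun u hu =>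
    (hc u hu).trans (by linarith)

end FailureProbability

section Law

lemma multivariateGaussian_sq_smul_one {ι : Type*} [Fintype ι] [DecidableEq ι]
    (μ : EuclideanSpace ℝ ι) {σ : ℝ} (hσ : 0 ≤ σ) :
    multivariateGaussian μ (σ ^ 2 • (1 : Matrix ι ι ℝ))
      = (stdGaussian (EuclideanSpace ℝ ι)).map (fun x => μ + σ • x) := by
  refine Measure.ext_of_charFun (funext fun z => ?_)
  have hchar : charFun ((stdGaussian (EuclideanSpace ℝ ι)).map (fun x => μ + σ • x)) z
      = Complex.exp (⟪μ, z⟫ * Complex.I) *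
        charFun (stdGaussian (EuclideanSpace ℝ ι)) (σ • z) := by
    rw [charFun_apply, charFun_apply, integral_map (by fun_prop) (by fun_prop),
      ← integral_const_mul]
    congr with x
    rw [← Complex.exp_add, inner_add_left, real_inner_smul_left, real_inner_smul_right]
    congr 1; push_cast; ring
  have hcov : z.ofLp ⬝ᵥ (σ ^ 2 • (1 : Matrix ι ι ℝ)).mulVec z.ofLp = (σ * ‖z‖) ^ 2 := by
    rw [Matrix.smul_mulVec, Matrix.one_mulVec, dotProduct_smul, mul_pow,
      EuclideanSpace.real_norm_sq_eq]
    simp only [dotProduct, sq, smul_eq_mul]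
  rw [charFun_multivariateGaussian (Matrix.PosSemidef.one.smul (sq_nonneg σ)), hchar,
    charFun_stdGaussian, ← Complex.exp_add, hcov, norm_smul, Real.norm_of_nonneg hσ,
    real_inner_comm]
  push_cast
  ring_nf

lemma map_prodMk_eq_pi_prod_pi {Ω K 𝓧 𝓨 : Type*} [MeasurableSpace Ω] {P : Measure Ω}
    [IsProbabilityMeasure P] [Fintype K] [MeasurableSpace 𝓧] [MeasurableSpace 𝓨]
    {X : K → Ω → 𝓧} {Y : K → Ω → 𝓨} (hX : ∀ k, AEMeasurable (X k) P)
    (hY : ∀ k, AEMeasurable (Y k) P) (hpairs : iIndepFun (fun k ω => (X k ω, Y k ω)) P)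
    (hXY : ∀ k, IndepFun (X k) (Y k) P) :
    P.map (fun ω => (fun k => X k ω, fun k => Y k ω))
      = (Measure.pi fun k => P.map (X k)).prod (Measure.pi fun k => P.map (Y k)) := by
  have : ∀ k, IsProbabilityMeasure (P.map (X k)) := fun k =>
    Measure.isProbabilityMeasure_map (hX k)
  have : ∀ k, IsProbabilityMeasure (P.map (Y k)) := fun k =>
    Measure.isProbabilityMeasure_map (hY k)
  have hm : ∀ k, AEMeasurable (fun ω => (X k ω, Y k ω)) P := fun k => (hX k).prodMk (hY k)
  have hpi := (iIndepFun_iff_map_fun_eq_pi_map hm).1 hpairs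
  simp only [fun k => (indepFun_iff_map_prod_eq_prod_map_map (hX k) (hY k)).1 (hXY k)] at hpi
  rw [← (measurePreserving_arrowProdEquivProdArrow 𝓧 𝓨 K _ _).map_eq, ← hpi,
    AEMeasurable.map_map_of_aemeasurable (by fun_prop) (aemeasurable_pi_lambda _ hm)]
  rfl

variable {E F K : Type*} [NormedAddCommGroup E] [InnerProductSpace ℝ E] [FiniteDimensional ℝ E]
  [MeasurableSpace E] [BorelSpace E] [NormedAddCommGroup F] [InnerProductSpace ℝ F]
  [FiniteDimensional ℝ F] [MeasurableSpace F] [BorelSpace F] [Fintype K]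

lemma map_affineSamples (μ : K → E) (σ σ' : ℝ) :
    ((stdGaussianPi K E).prod (stdGaussianPi K F)).map (affineSamples μ σ σ')
      = (Measure.pi fun k => (stdGaussian E).map (fun x => μ k + σ • x)).prod
        (Measure.pi fun _ => (stdGaussian F).map (fun x => σ' • x)) := by
  have : ∀ k, IsProbabilityMeasure ((stdGaussian E).map (fun x => μ k + σ • x)) := fun k =>
    Measure.isProbabilityMeasure_map (by fun_prop)
  have : IsProbabilityMeasure ((stdGaussian F).map (fun x => σ' • x)) :=
    Measure.isProbabilityMeasure_map (by fun_prop)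
  rw [← Measure.pi_map_pi fun k => by fun_prop, ← Measure.pi_map_pi fun _ => by fun_prop,
    Measure.map_prod_map _ _ (by fun_prop) (by fun_prop)]
  rfl

end Law

section Window

variable {α : Type*} {m p q : ℕ}

/-- The indices of the samples collected by `m` agents up to time `t`. -/
abbrev SampleIndex (m : ℕ) (t : ℕ+) : Type := Fin m × Finset.Icc (1 : ℕ+) t

/-- The restriction of a double sequence to the samples collected up to time `t`. -/
def window (u : Fin m → ℕ+ → α) (t : ℕ+) : SampleIndex m t → α := fun k => u k.1 k.2

lemma card_sampleIndex (m : ℕ) (t : ℕ+) : (Fintype.card (SampleIndex m t) : ℝ) = m * t := by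
  simp

lemma crossSum_eq_crossMatrix (u : Fin m → ℕ+ → EuclideanSpace ℝ (Fin p))
    (v : Fin m → ℕ+ → EuclideanSpace ℝ (Fin q)) (t : ℕ+) :
    crossSum u v t = crossMatrix (window u t) (window v t) := by
  rw [crossSum, crossMatrix, Fintype.sum_prod_type]
  exact Finset.sum_congr rfl fun i _ => (Finset.sum_coe_sort _ _).symm

lemma meanGram_eq_smul_crossMatrix (μ : Fin m → ℕ+ → EuclideanSpace ℝ (Fin p)) (σ : ℝ) (t : ℕ+) :
    meanGram μ σ t = (4 / (m * t * σ ^ 2)) • crossMatrix (window μ t) (window μ t) := by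
  rw [meanGram, crossSum_eq_crossMatrix]

lemma one_le_lambdaMin_one_add_meanGram (hp : 0 < p) (μ : Fin m → ℕ+ → EuclideanSpace ℝ (Fin p))
    (σ : ℝ) (t : ℕ+) : 1 ≤ lambdaMin (1 + meanGram μ σ t) := by
  rw [meanGram_eq_smul_crossMatrix]
  exact one_le_lambdaMin_one_add_smul_crossMatrix hp (by positivity) _

lemma mul_lambdaMin_one_add_meanGram_le (hm : 0 < m) (hp : 0 < p)
    (μ : Fin m → ℕ+ → EuclideanSpace ℝ (Fin p)) {σ : ℝ} (hσ : 0 < σ) (t : ℕ+)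
    {u : EuclideanSpace ℝ (Fin p)} (hu : ‖u‖ = 1) :
    m * t * σ ^ 2 / 8 * lambdaMin (1 + meanGram μ σ t)
      ≤ m * t * σ ^ 2 / 8 + crossForm (window μ t) (window μ t) u u := by
  rw [meanGram_eq_smul_crossMatrix]
  set a := window μ t
  set N : ℝ := m * t
  have hN : 0 < N := by positivity
  have hray := (le_lambdaMin_iff hp (isHermitian_one_add_smul_crossMatrix (4 / (N * σ ^ 2)) a)
    _).1 le_rfl u
  rw [inner_toEuclideanLin_one_add_smul_crossMatrix, hu, one_pow, mul_one] at hray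
  calc N * σ ^ 2 / 8 * lambdaMin (1 + (4 / (N * σ ^ 2)) • crossMatrix a a)
      ≤ N * σ ^ 2 / 8 * (1 + 4 / (N * σ ^ 2) * crossForm a a u u) := by gcongr
    _ = N * σ ^ 2 / 8 + crossForm a a u u / 2 := by field_simp; ring
    _ ≤ N * σ ^ 2 / 8 + crossForm a a u u := by linarith [crossForm_self_nonneg a u]

end Window

section Model

lemma one_sub_le_measureReal {Ω : Type*} [MeasurableSpace Ω] {P : Measure Ω}
    [IsProbabilityMeasure P] {s : Set Ω} {ε : ℝ} (hε : 0 ≤ ε) (h : P sᶜ ≤ ENNReal.ofReal ε) :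
    1 - ε ≤ P.real s := by
  have hcompl : P.real sᶜ ≤ ε := ENNReal.toReal_le_of_le_ofReal hε h
  have hunion := measureReal_union_le (μ := P) s sᶜ
  rw [Set.union_compl_self, probReal_univ] at hunion
  linarith

variable {Ω : Type*} [MeasurableSpace Ω] {P : Measure Ω} {m n l : ℕ}
  {Θ : Matrix (Fin l) (Fin n) ℝ} {μ : Fin m → ℕ+ → EuclideanSpace ℝ (Fin n)} {σx ση μhat : ℝ}
  {x : Fin m → ℕ+ → Ω → EuclideanSpace ℝ (Fin n)}
  {η y : Fin m → ℕ+ → Ω → EuclideanSpace ℝ (Fin l)}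

lemma GaussianModel.norm_mean_le (hmodel : GaussianModel P Θ μ σx ση μhat x η y) (i : Fin m)
    (j : ℕ+) : ‖μ i j‖ ≤ μhat :=
  hmodel.sup_mean.1 ⟨(i, j), rfl⟩

lemma GaussianModel.mean_bound_nonneg (hmodel : GaussianModel P Θ μ σx ση μhat x η y)
    (hm : 0 < m) : 0 ≤ μhat :=
  (norm_nonneg _).trans (hmodel.norm_mean_le ⟨0, hm⟩ 1)

lemma GaussianModel.aemeasurable_samples (hmodel : GaussianModel P Θ μ σx ση μhat x η y)
    (t : ℕ+) :
    AEMeasurable (fun ω => (window (fun i j => x i j ω) t, window (fun i j => η i j ω) t)) P :=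
  .prodMk
    (aemeasurable_pi_lambda _ fun k => (hmodel.law_feature k.1 k.2).aemeasurable)
    (aemeasurable_pi_lambda _ fun k => (hmodel.law_noise k.1 k.2).aemeasurable)

variable [IsProbabilityMeasure P]

lemma GaussianModel.map_samples (hmodel : GaussianModel P Θ μ σx ση μhat x η y) (hσx : 0 ≤ σx)
    (hση : 0 ≤ ση) (t : ℕ+) :
    P.map (fun ω => (window (fun i j => x i j ω) t, window (fun i j => η i j ω) t))
      = ((stdGaussianPi (SampleIndex m t) (EuclideanSpace ℝ (Fin n))).prod
          (stdGaussianPi (SampleIndex m t) (EuclideanSpace ℝ (Fin l)))).map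
        (affineSamples (window μ t) σx ση) := by
  have hinj : Function.Injective (Prod.map id Subtype.val : SampleIndex m t → Fin m × ℕ+) :=
    Function.injective_id.prodMap Subtype.val_injective
  rw [map_affineSamples]
  refine (map_prodMk_eq_pi_prod_pi (K := SampleIndex m t)
    (fun k => (hmodel.law_feature k.1 k.2).aemeasurable)
    (fun k => (hmodel.law_noise k.1 k.2).aemeasurable) (hmodel.indep_pairs.precomp hinj)
    fun k => hmodel.indep_feature_noise k.1 k.2).trans ?_
  simp only [(hmodel.law_feature _ _).map_eq, (hmodel.law_noise _ _).map_eq,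
    multivariateGaussian_sq_smul_one _ hσx, multivariateGaussian_sq_smul_one _ hση, zero_add,
    window]

lemma GaussianModel.one_sub_le_measureReal_goodSamples
    (hmodel : GaussianModel P Θ μ σx ση μhat x η y) (hm : 0 < m) (hn : 0 < n) (hσx : 0 < σx)
    (hση : 0 ≤ ση) {δ : ℝ} (hδ : 0 < δ) (hδ4 : δ < 1 / 4) (t : ℕ+) (h₁ : t1 n δ ≤ m * t)
    (h₂ : t2 n σx μhat δ ≤ m * t) (h₃ : t3 n l δ ≤ m * t) :
    1 - 4 * δ ≤ P.real
      ((fun ω => (window (fun i j => x i j ω) t, window (fun i j => η i j ω) t)) ⁻¹'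
        goodSamples _ _ _ (m * t * σx ^ 2 / 8 * lambdaMin (1 + meanGram μ σx t))
          (√(m * t) * C1 n l σx ση μhat δ / 8)) := by
  have : Nonempty (Fin n) := ⟨⟨0, hn⟩⟩
  have hμ : ∀ k, ‖window μ t k‖ ≤ μhat := fun k => hmodel.norm_mean_le k.1 k.2
  refine one_sub_le_measureReal (by positivity) ?_
  have hfail := measure_affineSamples_notMem_goodSamples_le (E := EuclideanSpace ℝ (Fin n))
    (F := EuclideanSpace ℝ (Fin l)) (K := SampleIndex m t) hσx hση
    (hmodel.mean_bound_nonneg hm) hμ hδ hδ4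
  simp only [finrank_euclideanSpace_fin, card_sampleIndex] at hfail
  rw [← Set.preimage_compl, ← Measure.map_apply_of_aemeasurable (hmodel.aemeasurable_samples t)
    (isClosed_goodSamples _ _).measurableSet.compl, hmodel.map_samples hσx.le hση,
    Measure.map_apply (by fun_prop) (isClosed_goodSamples _ _).measurableSet.compl]
  exact hfail h₁ h₂ h₃ fun u hu => mul_lambdaMin_one_add_meanGram_le hm hn μ hσx t hu

lemma isUnit_crossSum_and_norm_globalEstimate_sub_le {x : Fin m → ℕ+ → EuclideanSpace ℝ (Fin n)}
    {η y : Fin m → ℕ+ → EuclideanSpace ℝ (Fin l)}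
    (hy : ∀ i j, y i j = Matrix.toEuclideanLin Θ (x i j) + η i j) {c r : ℝ} (hc : 0 < c)
    (hr : 0 ≤ r) {t : ℕ+} (hgood : (window x t, window η t) ∈ goodSamples _ _ _ c r) :
    IsUnit (crossSum x x t) ∧ ‖globalEstimate x y t - Θ‖ ≤ r / c := by
  have hwindow : window y t = fun k => Matrix.toEuclideanLin Θ (window x t k) + window η t k :=
    funext fun k => hy k.1 k.2
  rw [globalEstimate, crossSum_eq_crossMatrix, crossSum_eq_crossMatrix, hwindow]
  exact ⟨isUnit_crossMatrix_of_mem_goodSamples hc hgood,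
    norm_leastSquares_sub_le hc hr hgood Θ⟩

end Model

lemma C1_nonneg (n l : ℕ) {σx ση μhat : ℝ} (δ : ℝ) (hσx : 0 ≤ σx) (hση : 0 ≤ ση)
    (hμhat : 0 ≤ μhat) : 0 ≤ C1 n l σx ση μhat δ := by
  unfold C1; positivity

lemma sqrt_mul_div_mul_eq (N s C lam : ℝ) :
    √N * C / 8 / (N * s / 8 * lam) = C / (√N * s * lam) := by
  linear_combination (C / (s * lam)) * (Real.sqrt_div_self : √N / N = (√N)⁻¹)

end DistEst

end

theorem theorem2 {Ω : Type*} [MeasurableSpace Ω] (P : Measure Ω) [IsProbabilityMeasure P]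
    {m n l : ℕ} (hm : 0 < m) (hn : 0 < n)
    (Θ : Matrix (Fin l) (Fin n) ℝ) (μ : Fin m → ℕ+ → EuclideanSpace ℝ (Fin n))
    (σx ση μhat : ℝ) (hσx : 0 < σx) (hση : 0 ≤ ση)
    (x : Fin m → ℕ+ → Ω → EuclideanSpace ℝ (Fin n))
    (η y : Fin m → ℕ+ → Ω → EuclideanSpace ℝ (Fin l))
    (hmodel : DistEst.GaussianModel P Θ μ σx ση μhat x η y)
    (δ : ℝ) (hδ : 0 < δ) (t : ℕ+)
    (ht : (1 / (m : ℝ)) * max (DistEst.t1 n δ)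
      (max (DistEst.t2 n σx μhat δ) (DistEst.t3 n l δ)) ≤ (t : ℝ)) :
    1 - 4 * δ ≤ P.real {ω |
      IsUnit (DistEst.crossSum (fun i j => x i j ω) (fun i j => x i j ω) t) ∧
      ‖DistEst.globalEstimate (fun i j => x i j ω) (fun i j => y i j ω) t - Θ‖ ≤
        DistEst.C1 n l σx ση μhat δ /
          (√((m : ℝ) * (t : ℝ)) * σx ^ 2 *
            DistEst.lambdaMin (1 + DistEst.meanGram μ σx t))} := by
  rcases le_or_gt (1 / 4) δ with hδ4 | hδ4
  · exact (by linarith : 1 - 4 * δ ≤ 0).trans measureReal_nonneg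
  rw [one_div, inv_mul_le_iff₀ (by positivity), max_le_iff, max_le_iff] at ht
  obtain ⟨h₁, h₂, h₃⟩ := ht
  have hlam := DistEst.one_le_lambdaMin_one_add_meanGram hn μ σx t
  have hC := DistEst.C1_nonneg n l δ hσx.le hση (hmodel.mean_bound_nonneg hm)
  refine (hmodel.one_sub_le_measureReal_goodSamples hm hn hσx hση hδ hδ4 t h₁ h₂ h₃).trans
    (measureReal_mono fun ω hω => ?_)
  rw [Set.mem_ofPred_eq, ← DistEst.sqrt_mul_div_mul_eq]
  exact DistEst.isUnit_crossSum_and_norm_globalEstimate_sub_le (fun i j => hmodel.label i j ω)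
    (by positivity) (by positivity) hω
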